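/- Let $\Lambda_\mu=\mathbb Z[t_1^{\pm1},\dots,t_\mu^{\pm1}]$, $\Lambda=\mathbb Z[t^{\pm1}]$, let $I_\mu$ be the kernel of the augmentation $\Lambda_\mu\to\mathbb Z$, $t_i\mapsto 1$, and let $\tau:\Lambda_\mu\to\Lambda$ be the ring homomorphism with $\tau(t_i)=t$ for all $i$, which makes $\Lambda$ a $\Lambda_\mu$-module. Let $L=K_1\cup\dots\cup K_\mu$ be a classical oriented link with a diagram $D$, with set of arcs $A(D)$, set of crossings $C(D)$, and $\kappa(a)=i$ if the arc $a$ belongs to $K_i$. The Alexander module $M_A(L)$ is the $\Lambda_\mu$-module with a generator $\gamma(a)$ for each $a\in A(D)$ and a relation $(1-t_{\kappa(a_2)})\gamma(a_1)+t_{\kappa(a_1)}\gamma(a_2)-\gamma(a_3)=0$ for each crossing, where $a_1$ is the overpassing arc and $a_2$, $a_3$ are the underpassing arcs to its right and to its left. The Crowell map $\phi_L:M_A(L)\to I_\mu$ is the $\Lambda_\mu$-linear map with $\phi_L(\gamma(a))=t_{\kappa(a)}-1$. The operation $x\triangleright y=(\phi_L(y)+1)x-\phi_L(x)y$ makes $\{x\in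 M_A(L):\phi_L(x)+1\text{ is a unit}\}$ a quandle, and $Q_A(L)$ is its subquandle generated by the elements $\gamma(a)$, $a\in A(D)$. Let $M_A^{red}(L)=M_A(L)\otimes_{\Lambda_\mu}\Lambda$, let $\phi_\tau=\phi_L\otimes\mathrm{id}_\Lambda:M_A^{red}(L)\to I_\mu\otimes_{\Lambda_\mu}\Lambda$, and let $Q_A^{red}(L)=\{x\otimes1\mid x\in Q_A(L)\}\subset M_A^{red}(L)$, a quandle under $(x\otimes1)\triangleright(y\otimes1)=(x\triangleright y)\otimes1$. Two $\mu$-component links $L,L'$ are $\phi_\tau$-equivalent if there is a $\Lambda$-module isomorphism $f:M_A^{red}(L)\to M_A^{red}(L')$ with $\phi_\tau=\phi'_\tau\circ f$. **Theorem.** As an invariant of classical links, $Q_A^{red}(L)$ (up to quandle isomorphism) is equivalent to $\phi_\tau$ (up to $\phi_\tau$-equivalence and permutation of component indices). That is: 1. If $D$ and $D'$ are diagrams of equivalent oriented links (with corresponding component indices), then the quandles $Q_A^{red}$ defined from $D$ and from $D'$ are isomorphic, and the maps $\phi_\tau$ defined from $D$ and from $D'$ are $\phi_\tau$-equivalent.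 2. If $L$ and $L'$ are classical oriented links with $\mu$ and $\mu'$ components, then $Q_A^{red}(L)\cong Q_A^{red}(L')$ as quandles if and only if $\mu=\mu'$ and the components of $L$ can be re-indexed by a permutation of $\{1,\dots,\mu\}$ so that the resulting link is $\phi_\tau$-equivalent to $L'$. -/

import Mathlib

open scoped TensorProduct LaurentPolynomial Quandles

noncomputable section

/-! ### Oriented link diagrams -/

/-- A signed Gauss diagram with `μ` indexed components: finitely many oriented closed curves, with
finitely many points (nodes) marked on them, at least one on each curve. `next` sends a node to the
following node in the direction of the orientation. Each crossing `c` consists of two nodes, the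
point `overNode c` of the overpassing strand and the point `underNode c` of the underpassing strand; a node
that belongs to no crossing is just a vertex of the curve. `κ` is the index of the component. -/
structure GaussDiagram (μ : ℕ) where
  Node : Type
  Crossing : Type
  finite_node : Finite Node
  finite_crossing : Finite Crossing
  next : Equiv.Perm Node
  overNode : Crossing → Node
  underNode : Crossing → Node
  crossing_injective : Function.Injective (Sum.elim overNode underNode)
  sign : Crossing → ℤˣ
  κ : Node → Fin μ
  κ_surjective : Function.Surjective κ
  κ_eq_iff : ∀ x y, κ x = κ y ↔ next.SameCycle x y

namespace GaussDiagram

variable {μ : ℕ} (D : GaussDiagram μ)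

/-- A half-edge: `(x, true)` is the beginning of the edge that leaves the node `x`, and
`(x, false)` is the end of the edge that arrives at `x`. -/
abbrev HalfEdge : Type := D.Node × Bool

/-- The other half of the same edge. -/
def flip : D.HalfEdge → D.HalfEdge
  | (x, true) => (D.next x, false)
  | (x, false) => (D.next.symm x, true)

/-- `Rot h k`: around their common vertex, the half-edge `k` is next to `h` in the counterclockwise
direction. At a crossing of sign `1`, the underpassing strand passes from the right of the
overpassing strand to its left; at a crossing of sign `-1`, it passes from left to right. -/
inductive Rot : D.HalfEdge → D.HalfEdge → Prop
  | vertex (x : D.Node) (s : Bool) (ho : ∀ c, D.overNode c ≠ x) (hu : ∀ c, D.underNode c ≠ x) :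
      Rot (x, s) (x, !s)
  | pos₁ (c : D.Crossing) (h : D.sign c = 1) : Rot (D.overNode c, true) (D.underNode c, true)
  | pos₂ (c : D.Crossing) (h : D.sign c = 1) : Rot (D.underNode c, true) (D.overNode c, false)
  | pos₃ (c : D.Crossing) (h : D.sign c = 1) : Rot (D.overNode c, false) (D.underNode c, false)
  | pos₄ (c : D.Crossing) (h : D.sign c = 1) : Rot (D.underNode c, false) (D.overNode c, true)
  | neg₁ (c : D.Crossing) (h : D.sign c = -1) : Rot (D.overNode c, true) (D.underNode c, false)
  | neg₂ (c : D.Crossing) (h : D.sign c = -1) : Rot (D.underNode c, false) (D.overNode c, false)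
  | neg₃ (c : D.Crossing) (h : D.sign c = -1) : Rot (D.overNode c, false) (D.underNode c, true)
  | neg₄ (c : D.Crossing) (h : D.sign c = -1) : Rot (D.underNode c, true) (D.overNode c, true)

/-- The faces of the rotation system: cross an edge, then turn to the next half-edge. -/
def Face : Type := Quot fun h k : D.HalfEdge => D.Rot (D.flip h) k

/-- One step inside a connected component of the underlying 4-valent graph. -/
inductive Joined : D.Node → D.Node → Prop
  | next (x : D.Node) : Joined x (D.next x)
  | crossing (c : D.Crossing) : Joined (D.overNode c) (D.underNode c)

/-- The connected components of the union of the curves. -/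
def Piece : Type := Quot D.Joined

/-- The diagram can be drawn in the plane: `V - E + F = 2 k`, where `k` is the number of connected
pieces. Here `V` is the number of nodes minus the number of crossings, and `E` is the number of
nodes. -/
def Planar : Prop :=
  Nat.card D.Face = Nat.card D.Crossing + 2 * Nat.card D.Piece

/-- Change the indices of the components according to `σ`. -/
def reindex {ν : ℕ} (σ : Fin μ ≃ Fin ν) : GaussDiagram ν where
  Node := D.Node
  Crossing := D.Crossing
  finite_node := D.finite_node
  finite_crossing := D.finite_crossing
  next := D.next
  overNode := D.overNode
  underNode := D.underNode
  crossing_injective := D.crossing_injective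
  sign := D.sign
  κ := fun x => σ (D.κ x)
  κ_surjective := σ.surjective.comp D.κ_surjective
  κ_eq_iff := fun x y => by rw [σ.injective.eq_iff]; exact D.κ_eq_iff x y

theorem rot_of_reindex {ν : ℕ} (σ : Fin μ ≃ Fin ν) {h k : (D.reindex σ).HalfEdge}
    (hr : (D.reindex σ).Rot h k) : D.Rot h k := by
  cases hr with
  | vertex x s ho hu => exact Rot.vertex (D := D) x s ho hu
  | pos₁ c h => exact Rot.pos₁ (D := D) c h
  | pos₂ c h => exact Rot.pos₂ (D := D) c h
  | pos₃ c h => exact Rot.pos₃ (D := D) c h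
  | pos₄ c h => exact Rot.pos₄ (D := D) c h
  | neg₁ c h => exact Rot.neg₁ (D := D) c h
  | neg₂ c h => exact Rot.neg₂ (D := D) c h
  | neg₃ c h => exact Rot.neg₃ (D := D) c h
  | neg₄ c h => exact Rot.neg₄ (D := D) c h

theorem rot_reindex {ν : ℕ} (σ : Fin μ ≃ Fin ν) {h k : D.HalfEdge}
    (hr : D.Rot h k) : (D.reindex σ).Rot h k := by
  cases hr with
  | vertex x s ho hu => exact Rot.vertex (D := D.reindex σ) x s ho hu
  | pos₁ c h => exact Rot.pos₁ (D := D.reindex σ) c h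
  | pos₂ c h => exact Rot.pos₂ (D := D.reindex σ) c h
  | pos₃ c h => exact Rot.pos₃ (D := D.reindex σ) c h
  | pos₄ c h => exact Rot.pos₄ (D := D.reindex σ) c h
  | neg₁ c h => exact Rot.neg₁ (D := D.reindex σ) c h
  | neg₂ c h => exact Rot.neg₂ (D := D.reindex σ) c h
  | neg₃ c h => exact Rot.neg₃ (D := D.reindex σ) c h
  | neg₄ c h => exact Rot.neg₄ (D := D.reindex σ) c h

theorem joined_of_reindex {ν : ℕ} (σ : Fin μ ≃ Fin ν) {x y : (D.reindex σ).Node}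
    (hr : (D.reindex σ).Joined x y) : D.Joined x y := by
  cases hr with
  | next => exact Joined.next (D := D) x
  | crossing c => exact Joined.crossing (D := D) c

theorem joined_reindex {ν : ℕ} (σ : Fin μ ≃ Fin ν) {x y : D.Node}
    (hr : D.Joined x y) : (D.reindex σ).Joined x y := by
  cases hr with
  | next => exact Joined.next (D := D.reindex σ) x
  | crossing c => exact Joined.crossing (D := D.reindex σ) c

theorem Planar.reindex {D : GaussDiagram μ} (h : D.Planar) {ν : ℕ} (σ : Fin μ ≃ Fin ν) :
    (D.reindex σ).Planar := by
  have e : (D.reindex σ).Face ≃ D.Face :=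
    Quot.congr (Equiv.refl D.HalfEdge) fun a b => by
      have hf : (D.reindex σ).flip a = D.flip a := by
        rcases a with ⟨x, _ | _⟩ <;> rfl
      rw [hf]
      exact ⟨D.rot_of_reindex σ, D.rot_reindex σ⟩
  have p : (D.reindex σ).Piece ≃ D.Piece :=
    Quot.congr (Equiv.refl D.Node) fun _ _ => ⟨D.joined_of_reindex σ, D.joined_reindex σ⟩
  unfold Planar
  rw [Nat.card_congr e, Nat.card_congr p]
  exact h

/-! ### Arcs -/

/-- The edge that leaves `x` and the following edge, which leaves `next x`, belong to the same arc
unless the curve underpasses another strand at the node `next x`. -/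
def ArcStep (x y : D.Node) : Prop := y = D.next x ∧ ∀ c, D.underNode c ≠ y

/-- The arcs: the pieces obtained by cutting the curves at the underpasses. An edge is represented
by the node that it leaves. -/
def Arc : Type := Quot D.ArcStep

variable {D} in
/-- The arc that contains the edge leaving `x`. -/
def arcOf (x : D.Node) : D.Arc := Quot.mk _ x

/-- The index of the component that contains an arc. -/
def arcκ : D.Arc → Fin μ :=
  Quot.lift D.κ fun x y h => (D.κ_eq_iff x y).2 (by
    rw [h.1]; exact ⟨1, by simp⟩)

/-- The overpassing arc `a₁` of a crossing. -/
def overArc (c : D.Crossing) : D.Arc := arcOf (D.overNode c)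

/-- The underpassing arc `a₂` to the right of the overpassing arc. -/
def rightArc (c : D.Crossing) : D.Arc :=
  if D.sign c = 1 then arcOf (D.next.symm (D.underNode c)) else arcOf (D.underNode c)

/-- The underpassing arc `a₃` to the left of the overpassing arc. -/
def leftArc (c : D.Crossing) : D.Arc :=
  if D.sign c = 1 then arcOf (D.underNode c) else arcOf (D.next.symm (D.underNode c))

theorem arcκ_rightArc_eq_leftArc (c : D.Crossing) :
    D.arcκ (D.rightArc c) = D.arcκ (D.leftArc c) := by
  have h : D.κ (D.next.symm (D.underNode c)) = D.κ (D.underNode c) :=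
    (D.κ_eq_iff _ _).2 ⟨1, by simp⟩
  unfold rightArc leftArc
  split_ifs
  · exact h
  · exact h.symm

end GaussDiagram

/-! ### Classical link diagrams and link equivalence -/

/-- A diagram of a classical oriented link `K₁ ∪ ⋯ ∪ K_μ`. (The relative position in the plane of
distinct connected pieces of the diagram is not recorded; it does not affect the link type.) -/
structure LinkDiagram (μ : ℕ) extends GaussDiagram μ where
  planar : toGaussDiagram.Planar

namespace LinkDiagram

variable {μ : ℕ}

/-- Re-index the components of a link. -/
def reindex (D : LinkDiagram μ) {ν : ℕ} (σ : Fin μ ≃ Fin ν) : LinkDiagram ν where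
  toGaussDiagram := D.toGaussDiagram.reindex σ
  planar := D.planar.reindex σ

end LinkDiagram

namespace GaussDiagram

variable {μ : ℕ}

/-- `e` identifies the oriented curves of `D` and `D'`, with their nodes and indices (the crossings
are ignored). -/
def SameCurves (D D' : GaussDiagram μ) (e : D.Node ≃ D'.Node) : Prop :=
  (∀ x, e (D.next x) = D'.next (e x)) ∧ ∀ x, D'.κ (e x) = D.κ x

/-- `g` sends crossings of `D` to crossings of `D'` of the same sign, and the crossing nodes are
related by `f`. -/
def CrossingsMatch (D D' : GaussDiagram μ) (f : D.Node → D'.Node)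
    (g : D.Crossing → D'.Crossing) : Prop :=
  ∀ c, D'.overNode (g c) = f (D.overNode c) ∧ D'.underNode (g c) = f (D.underNode c) ∧ D'.sign (g c) = D.sign c

/-- The two diagrams are isomorphic. -/
def IsIso (D D' : GaussDiagram μ) : Prop :=
  ∃ (e : D.Node ≃ D'.Node) (g : D.Crossing ≃ D'.Crossing),
    SameCurves D D' e ∧ CrossingsMatch D D' e g

open Classical in
/-- `D'` is obtained from `D` by marking one more vertex `m` on an edge. -/
def AddVertex (D D' : GaussDiagram μ) : Prop :=
  ∃ (f : D.Node → D'.Node) (m : D'.Node) (g : D.Crossing ≃ D'.Crossing),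
    Function.Injective f ∧ Set.range f = {m}ᶜ ∧ CrossingsMatch D D' f g ∧
    (∀ x, D'.κ (f x) = D.κ x) ∧
    ∀ x, f (D.next x) = if D'.next (f x) = m then D'.next m else D'.next (f x)

/-- First Reidemeister move: `D'` has one more crossing, whose two nodes are consecutive. -/
def Reidemeister1 (D D' : GaussDiagram μ) : Prop :=
  ∃ (e : D.Node ≃ D'.Node) (g : D.Crossing → D'.Crossing) (c : D'.Crossing),
    SameCurves D D' e ∧ CrossingsMatch D D' e g ∧ Function.Injective g ∧ Set.range g = {c}ᶜ ∧
    (D'.next (D'.overNode c) = D'.underNode c ∨ D'.next (D'.underNode c) = D'.overNode c)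

/-- Second Reidemeister move: `D'` has two more crossings, of opposite signs, which are consecutive
on the overpassing strand and on the underpassing strand. -/
def Reidemeister2 (D D' : GaussDiagram μ) : Prop :=
  ∃ (e : D.Node ≃ D'.Node) (g : D.Crossing → D'.Crossing) (c d : D'.Crossing),
    SameCurves D D' e ∧ CrossingsMatch D D' e g ∧ Function.Injective g ∧ Set.range g = {c, d}ᶜ ∧
    D'.sign c = -D'.sign d ∧ D'.next (D'.overNode c) = D'.overNode d ∧
    (D'.next (D'.underNode c) = D'.underNode d ∨ D'.next (D'.underNode d) = D'.underNode c)

/-- `x` and `y` are consecutive, `x` being the first if `s = 1` and the second if `s = -1`. -/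
def Consecutive (D : GaussDiagram μ) (s : ℤˣ) (x y : D.Node) : Prop :=
  if s = 1 then D.next x = y else D.next y = x

open Classical in
/-- Third Reidemeister move. Three strands, top, middle and bottom, bound a triangle with corners
`a` (top over middle), `b` (top over bottom) and `c` (middle over bottom); the move reverses the
order in which each strand passes its two corners. The strands can be directed in any way: along
three lines, the signs of the crossings can be chosen at will, and together with one further sign
`δ`, which changes under the move, they determine the order of the corners on each line. -/
def Reidemeister3 (D D' : GaussDiagram μ) : Prop :=
  ∃ (e : D.Node ≃ D'.Node) (g : D.Crossing ≃ D'.Crossing) (a b c : D.Crossing) (δ : ℤˣ),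
    SameCurves D D' e ∧ a ≠ b ∧ a ≠ c ∧ b ≠ c ∧
    D.Consecutive (δ * D.sign b) (D.overNode a) (D.overNode b) ∧
    D.Consecutive (δ * D.sign c) (D.underNode a) (D.overNode c) ∧
    D.Consecutive (δ * D.sign a * D.sign b * D.sign c) (D.underNode b) (D.underNode c) ∧
    CrossingsMatch D D' (fun x => e (Equiv.swap (D.overNode a) (D.overNode b)
      (Equiv.swap (D.underNode a) (D.overNode c) (Equiv.swap (D.underNode b) (D.underNode c) x)))) g

/-- One elementary move. -/
def Move (D D' : GaussDiagram μ) : Prop :=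
  IsIso D D' ∨ AddVertex D D' ∨ Reidemeister1 D D' ∨ Reidemeister2 D D' ∨ Reidemeister3 D D'

end GaussDiagram

/-- Two diagrams represent equivalent oriented links (with indexed components): they are connected
by a finite sequence of Reidemeister moves between planar diagrams. -/
def LinkDiagram.Equivalent {μ : ℕ} : LinkDiagram μ → LinkDiagram μ → Prop :=
  Relation.EqvGen fun D D' => GaussDiagram.Move D.toGaussDiagram D'.toGaussDiagram

/-! ### Laurent polynomial rings -/

/-- `Λ_μ = ℤ[t₁^±1, …, t_μ^±1]`, the integral group ring of the free abelian group `ℤ^μ`. -/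
abbrev LaurentRing (μ : ℕ) : Type := AddMonoidAlgebra ℤ (Fin μ →₀ ℤ)

/-- The variable `t_i`. -/
def tvar {μ : ℕ} (i : Fin μ) : LaurentRing μ := AddMonoidAlgebra.single (Finsupp.single i 1) 1

/-- The augmentation map `ε : Λ_μ → ℤ`, with `ε (t_i^±1) = 1`. -/
def augmentation (μ : ℕ) : LaurentRing μ →+* ℤ :=
  (AddMonoidAlgebra.lift ℤ ℤ (Fin μ →₀ ℤ) 1 : LaurentRing μ →ₐ[ℤ] ℤ)

/-- The augmentation ideal `I_μ`. -/
def augIdeal (μ : ℕ) : Ideal (LaurentRing μ) := RingHom.ker (augmentation μ)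

/-- `τ : Λ_μ → Λ`, with `τ (t_i) = t`. -/
def tauHom (μ : ℕ) : LaurentRing μ →+* ℤ[T;T⁻¹] :=
  AddMonoidAlgebra.mapDomainRingHom ℤ (Finsupp.degree : (Fin μ →₀ ℤ) →+ ℤ)

/-- `Λ` as a `Λ_μ`-module via `τ`. -/
instance tauAlgebra (μ : ℕ) : Algebra (LaurentRing μ) ℤ[T;T⁻¹] := (tauHom μ).toAlgebra

theorem augmentation_tvar {μ : ℕ} (i : Fin μ) : augmentation μ (tvar i) = 1 := by
  simp [augmentation, tvar]

theorem tauHom_tvar {μ : ℕ} (i : Fin μ) : tauHom μ (tvar i) = LaurentPolynomial.T 1 := by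
  simp [tauHom, tvar, LaurentPolynomial.single_eq_C_mul_T]

/-- `t_i - 1`, as an element of `I_μ`. -/
def tvarSubOne {μ : ℕ} (i : Fin μ) : augIdeal μ :=
  ⟨tvar i - 1, by simp [augIdeal, RingHom.mem_ker, augmentation_tvar]⟩

/-! ### The Alexander module and the Crowell map -/

namespace LinkDiagram

variable {μ : ℕ} (D : LinkDiagram μ)

/-- The map `ρ_D` from the free module on the crossings to the free module on the arcs, with
`ρ_D(c) = (1 - t_{κ(a₂)}) a₁ + t_{κ(a₁)} a₂ - a₃`. -/
def rhoD : (D.Crossing →₀ LaurentRing μ) →ₗ[LaurentRing μ] (D.Arc →₀ LaurentRing μ) :=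
  Finsupp.linearCombination (LaurentRing μ) fun c : D.Crossing =>
    (1 - tvar (D.arcκ (D.rightArc c))) • Finsupp.single (D.overArc c) (1 : LaurentRing μ)
      + tvar (D.arcκ (D.overArc c)) • Finsupp.single (D.rightArc c) (1 : LaurentRing μ)
      - Finsupp.single (D.leftArc c) (1 : LaurentRing μ)

/-- The Alexander module `M_A(L)`, the cokernel of `ρ_D`. -/
abbrev AlexanderModule : Type :=
  (D.Arc →₀ LaurentRing μ) ⧸ LinearMap.range D.rhoD

/-- The projection `γ_D` onto the Alexander module. -/
def gammaD : (D.Arc →₀ LaurentRing μ) →ₗ[LaurentRing μ] D.AlexanderModule :=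
  (LinearMap.range D.rhoD).mkQ

/-- The element `γ_D(a)` for an arc `a`. -/
def gen (a : D.Arc) : D.AlexanderModule := D.gammaD (Finsupp.single a 1)

/-- The map of the free module on the arcs that induces the Crowell map. -/
def crowellPre : (D.Arc →₀ LaurentRing μ) →ₗ[LaurentRing μ] augIdeal μ :=
  Finsupp.linearCombination (LaurentRing μ) fun a => tvarSubOne (D.arcκ a)

theorem range_rhoD_le : LinearMap.range D.rhoD ≤ LinearMap.ker D.crowellPre := by
  rw [LinearMap.range_le_ker_iff]
  refine Finsupp.lhom_ext' fun c => LinearMap.ext_ring ?_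
  apply Subtype.ext
  simp only [rhoD, crowellPre, LinearMap.comp_apply, Finsupp.lsingle_apply,
    Finsupp.linearCombination_single, one_smul, map_add, map_sub, map_smul,
    D.arcκ_rightArc_eq_leftArc c, tvarSubOne]
  simp only [AddSubgroupClass.coe_sub, Submodule.coe_add, Submodule.coe_smul, smul_eq_mul,
    LinearMap.zero_apply, ZeroMemClass.coe_zero]
  ring

/-- The Crowell map `φ_L : M_A(L) → I_μ`, with `φ_L(γ_D(a)) = t_{κ(a)} - 1`. -/
def crowell : D.AlexanderModule →ₗ[LaurentRing μ] augIdeal μ :=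
  (LinearMap.range D.rhoD).liftQ D.crowellPre D.range_rhoD_le

theorem crowell_gen (a : D.Arc) : D.crowell (D.gen a) = tvarSubOne (D.arcκ a) := by
  simp [crowell, gen, gammaD, crowellPre]

/-- The reduced Alexander module `M_A^red(L)`. The factors of the tensor product are written in
the order in which the first one acts by scalars. -/
abbrev ReducedModule : Type := ℤ[T;T⁻¹] ⊗[LaurentRing μ] D.AlexanderModule

/-- The reduced Crowell map `φ_τ`, the tensor product of `φ_L` with the identity of `Λ`. -/
def phiTau : D.ReducedModule →ₗ[ℤ[T;T⁻¹]] ℤ[T;T⁻¹] ⊗[LaurentRing μ] augIdeal μ :=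
  D.crowell.baseChange ℤ[T;T⁻¹]

/-- `φ_τ`-equivalence. -/
def PhiTauEquivalent (D D' : LinkDiagram μ) : Prop :=
  ∃ f : D.ReducedModule ≃ₗ[ℤ[T;T⁻¹]] D'.ReducedModule, ∀ x, D.phiTau x = D'.phiTau (f x)

end LinkDiagram

/-! ### Quandles -/

/-- Two quandles are isomorphic. (In Mathlib's notation, `y ◃ x` is what is often written
`x ▷ y`.) -/
def QuandleIsomorphic (P Q : Type) [Quandle P] [Quandle Q] : Prop :=
  ∃ f : P ≃ Q, ∀ x y, f (x ◃ y) = f x ◃ f y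

/-- The underlying set of the subquandle generated by `S`. -/
inductive SubquandleClosure {Q : Type} [Quandle Q] (S : Set Q) : Q → Prop
  | basic {x : Q} (hx : x ∈ S) : SubquandleClosure S x
  | act {x y : Q} (hx : SubquandleClosure S x) (hy : SubquandleClosure S y) :
      SubquandleClosure S (x ◃ y)
  | invAct {x y : Q} (hx : SubquandleClosure S x) (hy : SubquandleClosure S y) :
      SubquandleClosure S (x ◃⁻¹ y)

namespace LinkDiagram

variable {μ : ℕ} (D : LinkDiagram μ)

/-- `φ_L` as a linear functional. -/
def crowellVal : D.AlexanderModule →ₗ[LaurentRing μ] LaurentRing μ :=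
  (augIdeal μ).subtype ∘ₗ D.crowell

/-- `U(L)`, the set of all `x` such that `φ_L(x) + 1` is a unit. -/
def UnitQuandle : Type := {x : D.AlexanderModule // IsUnit (D.crowellVal x + 1)}

/-- The operation `x ▷ y = (φ_L(y) + 1) x - φ_L(x) y` on the Alexander module. -/
def tri (x y : D.AlexanderModule) : D.AlexanderModule :=
  (D.crowellVal y + 1) • x - D.crowellVal x • y

theorem crowellVal_tri (x y : D.AlexanderModule) :
    D.crowellVal (D.tri x y) = D.crowellVal x := by
  simp only [tri, map_sub, map_smul, smul_eq_mul]
  ring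

/-- The inverse operation. -/
def triInv (x y : D.AlexanderModule) : D.AlexanderModule :=
  Ring.inverse (D.crowellVal y + 1) • (x + D.crowellVal x • y)

theorem crowellVal_triInv (x : D.AlexanderModule) {y : D.AlexanderModule}
    (hy : IsUnit (D.crowellVal y + 1)) : D.crowellVal (D.triInv x y) = D.crowellVal x := by
  simp only [triInv, map_add, map_smul, smul_eq_mul]
  have h : D.crowellVal x + D.crowellVal x * D.crowellVal y
      = (D.crowellVal y + 1) * D.crowellVal x := by ring
  rw [h, ← mul_assoc, Ring.inverse_mul_cancel _ hy, one_mul]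

theorem tri_triInv (x : D.AlexanderModule) {y : D.AlexanderModule}
    (hy : IsUnit (D.crowellVal y + 1)) : D.tri (D.triInv x y) y = x := by
  rw [tri, D.crowellVal_triInv x hy, triInv, smul_smul, Ring.mul_inverse_cancel _ hy, one_smul,
    add_sub_cancel_right]

theorem triInv_tri (x : D.AlexanderModule) {y : D.AlexanderModule}
    (hy : IsUnit (D.crowellVal y + 1)) : D.triInv (D.tri x y) y = x := by
  rw [triInv, D.crowellVal_tri, tri, sub_add_cancel, smul_smul, Ring.inverse_mul_cancel _ hy,
    one_smul]

/-- The quandle structure of `U(L)`. -/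
instance : Quandle D.UnitQuandle where
  act y x := ⟨D.tri x.1 y.1, by rw [crowellVal_tri]; exact x.2⟩
  invAct y x := ⟨D.triInv x.1 y.1, by rw [D.crowellVal_triInv _ y.2]; exact x.2⟩
  self_distrib := by
    intro x y z
    apply Subtype.ext
    simp only [tri, map_sub, map_smul, smul_eq_mul]
    module
  left_inv y x := Subtype.ext (D.triInv_tri x.1 y.2)
  right_inv y x := Subtype.ext (D.tri_triInv x.1 y.2)
  fix := by
    intro x
    apply Subtype.ext
    simp only [tri]
    module

theorem isUnit_crowellVal_gen (a : D.Arc) : IsUnit (D.crowellVal (D.gen a) + 1) := by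
  have h : D.crowellVal (D.gen a) + 1 = tvar (D.arcκ a) := by
    simp [crowellVal, crowell_gen, tvarSubOne]
  rw [h]
  refine IsUnit.of_mul_eq_one (AddMonoidAlgebra.single (Finsupp.single (D.arcκ a) (-1)) 1) ?_
  simp [tvar, AddMonoidAlgebra.single_mul_single, AddMonoidAlgebra.one_def]

/-- The element `γ_D(a)` of `U(L)`. -/
def unitGen (a : D.Arc) : D.UnitQuandle := ⟨D.gen a, D.isUnit_crowellVal_gen a⟩

/-- The fundamental multivariate Alexander quandle `Q_A(L)`, the subquandle of `U(L)` generated by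
the elements `γ_D(a)`. -/
def QA : Set D.UnitQuandle :=
  {x | SubquandleClosure (Set.range D.unitGen) x}

/-- `Q_A^red(L) = {x ⊗ 1 | x ∈ Q_A(L)}`. -/
def QAred : Set D.ReducedModule :=
  {z | ∃ x ∈ D.QA, z = (1 : ℤ[T;T⁻¹]) ⊗ₜ[LaurentRing μ] x.1}

theorem exists_crowellVal_of_mem_QA {x : D.UnitQuandle} (hx : x ∈ D.QA) :
    ∃ i, D.crowellVal x.1 = tvar i - 1 := by
  induction hx with
  | basic hx =>
    obtain ⟨a, rfl⟩ := hx
    exact ⟨D.arcκ a, by simp [unitGen, crowellVal, crowell_gen, tvarSubOne]⟩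
  | @act x y hx hy ihx ihy =>
    obtain ⟨i, hi⟩ := ihy
    exact ⟨i, by rw [← hi]; exact D.crowellVal_tri _ _⟩
  | @invAct x y hx hy ihx ihy =>
    obtain ⟨i, hi⟩ := ihy
    exact ⟨i, by rw [← hi]; exact D.crowellVal_triInv _ x.2⟩

theorem one_tmul_smul (r : LaurentRing μ) (x : D.AlexanderModule) :
    (1 : ℤ[T;T⁻¹]) ⊗ₜ[LaurentRing μ] (r • x)
      = tauHom μ r • ((1 : ℤ[T;T⁻¹]) ⊗ₜ[LaurentRing μ] x) := by
  rw [← TensorProduct.smul_tmul, TensorProduct.smul_tmul', Algebra.smul_def, smul_eq_mul]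
  rfl

/-- On `Q_A(L)` the operation of `U(L)` reduces to `t x + (1 - t) y`. -/
theorem one_tmul_tri {x y : D.UnitQuandle} (hx : x ∈ D.QA) (hy : y ∈ D.QA) :
    (1 : ℤ[T;T⁻¹]) ⊗ₜ[LaurentRing μ] (y ◃ x).1
      = (LaurentPolynomial.T 1 : ℤ[T;T⁻¹]) • ((1 : ℤ[T;T⁻¹]) ⊗ₜ[LaurentRing μ] x.1)
        + (1 - LaurentPolynomial.T 1 : ℤ[T;T⁻¹]) •
          ((1 : ℤ[T;T⁻¹]) ⊗ₜ[LaurentRing μ] y.1) := by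
  obtain ⟨i, hi⟩ := D.exists_crowellVal_of_mem_QA hx
  obtain ⟨j, hj⟩ := D.exists_crowellVal_of_mem_QA hy
  change (1 : ℤ[T;T⁻¹]) ⊗ₜ[LaurentRing μ] (D.tri x.1 y.1) = _
  rw [tri, hi, hj, TensorProduct.tmul_sub, one_tmul_smul, one_tmul_smul]
  simp only [map_sub, map_add, tauHom_tvar, map_one]
  module

theorem mem_QAred_act {x y : D.ReducedModule} (hx : x ∈ D.QAred) (hy : y ∈ D.QAred) :
    (LaurentPolynomial.T 1 : ℤ[T;T⁻¹]) • x + (1 - LaurentPolynomial.T 1 : ℤ[T;T⁻¹]) • y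
      ∈ D.QAred := by
  obtain ⟨x, hx, rfl⟩ := hx
  obtain ⟨y, hy, rfl⟩ := hy
  exact ⟨y ◃ x, SubquandleClosure.act hy hx, (D.one_tmul_tri hx hy).symm⟩

theorem T_neg_one_mul : (LaurentPolynomial.T (-1) : ℤ[T;T⁻¹]) * LaurentPolynomial.T 1 = 1 := by
  rw [← LaurentPolynomial.T_add]
  simp

theorem T_smul_inv (x y : D.ReducedModule) :
    (LaurentPolynomial.T (-1) : ℤ[T;T⁻¹]) •
        ((LaurentPolynomial.T 1 : ℤ[T;T⁻¹]) • x + (1 - LaurentPolynomial.T 1 : ℤ[T;T⁻¹]) • y)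
      + (1 - LaurentPolynomial.T (-1) : ℤ[T;T⁻¹]) • y = x := by
  rw [smul_add, smul_smul, smul_smul, mul_sub, T_neg_one_mul, mul_one]
  module

theorem T_inv_smul (x y : D.ReducedModule) :
    (LaurentPolynomial.T 1 : ℤ[T;T⁻¹]) •
        ((LaurentPolynomial.T (-1) : ℤ[T;T⁻¹]) • x
          + (1 - LaurentPolynomial.T (-1) : ℤ[T;T⁻¹]) • y)
      + (1 - LaurentPolynomial.T 1 : ℤ[T;T⁻¹]) • y = x := by
  rw [smul_add, smul_smul, smul_smul, mul_sub, mul_comm, T_neg_one_mul, mul_one]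
  module

theorem mem_QAred_invAct {x y : D.ReducedModule} (hx : x ∈ D.QAred) (hy : y ∈ D.QAred) :
    (LaurentPolynomial.T (-1) : ℤ[T;T⁻¹]) • x + (1 - LaurentPolynomial.T (-1) : ℤ[T;T⁻¹]) • y
      ∈ D.QAred := by
  obtain ⟨x, hx, rfl⟩ := hx
  obtain ⟨y, hy, rfl⟩ := hy
  have hz : y ◃⁻¹ x ∈ D.QA := SubquandleClosure.invAct hy hx
  refine ⟨y ◃⁻¹ x, hz, ?_⟩
  have h := D.one_tmul_tri hz hy
  rw [Rack.act_invAct_eq] at h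
  rw [h, T_smul_inv]

/-- The quandle structure of `Q_A^red(L)`, given by `(x ⊗ 1) ▷ (y ⊗ 1) = (x ▷ y) ⊗ 1`
(see `act_QAred`). It is well defined because it agrees with `t x + (1 - t) y`. -/
instance : Quandle D.QAred where
  act y x := ⟨_, D.mem_QAred_act x.2 y.2⟩
  invAct y x := ⟨_, D.mem_QAred_invAct x.2 y.2⟩
  self_distrib := by
    intro x y z
    apply Subtype.ext
    simp only
    module
  left_inv y x := Subtype.ext (D.T_smul_inv x.1 y.1)
  right_inv y x := Subtype.ext (D.T_inv_smul x.1 y.1)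
  fix := by
    intro x
    apply Subtype.ext
    simp only
    module

theorem act_QAred {x y : D.UnitQuandle} (hx : x ∈ D.QA) (hy : y ∈ D.QA) :
    ((⟨_, y, hy, rfl⟩ : D.QAred) ◃ (⟨_, x, hx, rfl⟩ : D.QAred)).1
      = (1 : ℤ[T;T⁻¹]) ⊗ₜ[LaurentRing μ] (y ◃ x).1 :=
  (D.one_tmul_tri hx hy).symm

end LinkDiagram

end

/-! Reducing to $\Lambda$ turns both quandle operations into `twist`: $a\mapsto
t^{\pm1}a+(1-t^{\pm1})o$. Hence $M_A^{red}(L)$ is the universal target of Alexander colorings of the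
diagram (`isColoring_nodeGen`, `exists_lift`), and $\phi_\tau$ is the linear map belonging to the
coloring with the value $e_i=(t_i-1)\otimes1$ on the component $K_i$.

Invariance. An elementary move puts the colorings of the two diagrams in correspondence, with the
same colors outside the edges it alters, and these colors determine the rest. By universality the
reduced modules are isomorphic, and since $\phi_\tau$ is itself a coloring, the isomorphism respects
it (`phiTauEquivalent_of_transfer`).

From $\phi_\tau$ to the quandle. The central fact is
$Q_A^{red}(L)=\phi_\tau^{-1}\{e_1,\dots,e_\mu\}$ (`mem_QAred_iff`), so a $\phi_\tau$-equivalence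
restricts to a quandle isomorphism. One inclusion holds because $t-1$ kills $e_i-e_j$, so that
acting does not change the value of $\phi_\tau$. For the other, $Q_A^{red}(L)$ is stable under
translation by $(1-t)d$, where $d$ is in the span of differences of its elements
(`add_smul_mem_QAred`), and these translations exhaust $\ker\phi_\tau$
(`mem_differences_of_phiTau_eq_zero`).

From the quandle to $\phi_\tau$. A quandle homomorphism carries the universal coloring to a
coloring, hence extends to a linear map (`exists_linearMap_of_quandleHom`). It sends the generators
of one component to elements with a common value $e_j$ of $\phi_\tau$ (`exists_index_map`). For an
isomorphism, the linear extension and the index map are both invertible; the latter gives $\mu=\mu'$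
and the permutation. -/

noncomputable section

open LaurentPolynomial

/-! ### Colorings of a diagram in a module over `ℤ[t, t⁻¹]` -/

section Twist

variable {X Y : Type} [AddCommGroup X] [Module ℤ[T;T⁻¹] X] [AddCommGroup Y] [Module ℤ[T;T⁻¹] Y]

/-- The Alexander quandle operation: `twist 1` sends `a` to `t a + (1 - t) o`, and `twist (-1)`
inverts it. -/
def twist (s : ℤˣ) (o a : X) : X :=
  (T (s : ℤ) : ℤ[T;T⁻¹]) • a + (1 - T (s : ℤ) : ℤ[T;T⁻¹]) • o

theorem twist_self (s : ℤˣ) (o : X) : twist s o o = o := by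
  unfold twist; module

theorem twist_neg_twist (s : ℤˣ) (o a : X) : twist (-s) o (twist s o a) = a := by
  have h : (T ((-s : ℤˣ) : ℤ) : ℤ[T;T⁻¹]) * T (s : ℤ) = 1 := by
    rw [← T_add]; simp
  unfold twist
  rw [smul_add, smul_smul, smul_smul, mul_sub, h]
  module

theorem twist_twist_neg (s : ℤˣ) (o a : X) : twist s o (twist (-s) o a) = a := by
  simpa using twist_neg_twist (-s) o a

theorem twist_left_injective (s : ℤˣ) (o : X) : Function.Injective (twist s o) :=
  Function.LeftInverse.injective (twist_neg_twist s o)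

/-- The map `twist s y` is affine, and `twist r m a` is an affine combination of `m` and `a`. This
self-distributivity, for any pair of signs, is the algebra behind the third Reidemeister move. -/
theorem twist_twist (s r : ℤˣ) (y m a : X) :
    twist s y (twist r m a) = twist r (twist s y m) (twist s y a) := by
  unfold twist; module

theorem map_twist (f : X →ₗ[ℤ[T;T⁻¹]] Y) (s : ℤˣ) (o a : X) :
    f (twist s o a) = twist s (f o) (f a) := by
  simp [twist]

theorem T_smul_eq_of_fixed {v : X} (h : (T 1 : ℤ[T;T⁻¹]) • v = v) (n : ℤ) :
    (T n : ℤ[T;T⁻¹]) • v = v := by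
  have h' : (T (-1) : ℤ[T;T⁻¹]) • v = v := by
    conv_lhs => rw [← h, smul_smul, ← T_add]
    simp
  induction n with
  | zero => simp
  | succ n ih => rw [add_comm, T_add, mul_smul, ih, h]
  | pred n ih => rw [sub_eq_neg_add, T_add, mul_smul, ih, h']

/-- Centered at `o`, the operation is multiplication by $t^{s}$. Colors with differences fixed by
$t$ therefore pass underneath each other unchanged. -/
theorem twist_eq_of_fixed (s : ℤˣ) {o a : X} (h : (T 1 : ℤ[T;T⁻¹]) • (a - o) = a - o) :
    twist s o a = a := by
  have h' := T_smul_eq_of_fixed h s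
  have : twist s o a = (T (s : ℤ) : ℤ[T;T⁻¹]) • (a - o) + o := by unfold twist; module
  rw [this, h', sub_add_cancel]

end Twist

namespace GaussDiagram

variable {μ ν : ℕ} (D : GaussDiagram μ)

theorem underNode_injective : Function.Injective D.underNode := fun _ _ h =>
  Sum.inr_injective (D.crossing_injective (show Sum.elim _ _ _ = Sum.elim _ _ _ from h))

theorem overNode_injective : Function.Injective D.overNode := fun _ _ h =>
  Sum.inl_injective (D.crossing_injective (show Sum.elim _ _ _ = Sum.elim _ _ _ from h))

theorem overNode_ne_underNode (a b : D.Crossing) : D.overNode a ≠ D.underNode b := fun h =>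
  Sum.inl_ne_inr (D.crossing_injective (a₁ := .inl a) (a₂ := .inr b) h)

/-- A coloring of the edges of `D` (an edge is represented by the node that it leaves): the color
does not change at a node that is no underpass, and changes by `twist` at an underpass. -/
structure IsColoring {X : Type} [AddCommGroup X] [Module ℤ[T;T⁻¹] X] (c : D.Node → X) : Prop where
  step : ∀ y, (∀ k, D.underNode k ≠ y) → c y = c (D.next.symm y)
  cross : ∀ k, c (D.underNode k) =
    twist (D.sign k) (c (D.overNode k)) (c (D.next.symm (D.underNode k)))

theorem IsColoring.map {D : GaussDiagram μ} {X Y : Type} [AddCommGroup X] [Module ℤ[T;T⁻¹] X]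
    [AddCommGroup Y] [Module ℤ[T;T⁻¹] Y] {c : D.Node → X} (h : D.IsColoring c)
    (f : X →ₗ[ℤ[T;T⁻¹]] Y) : D.IsColoring fun x => f (c x) where
  step y hy := by rw [h.step y hy]
  cross k := by rw [h.cross k, map_twist]

theorem isColoring_const {X : Type} [AddCommGroup X] [Module ℤ[T;T⁻¹] X] (v : X) :
    D.IsColoring fun _ => v where
  step _ _ := rfl
  cross _ := (twist_self _ _).symm

/-- Every coloring of `D` gives a coloring of `D'` that takes the same values at corresponding
nodes `p i` and `q i`. -/
def ColoringTransfer (D : GaussDiagram μ) (D' : GaussDiagram ν) {ι : Type} (p : ι → D.Node)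
    (q : ι → D'.Node) : Prop :=
  ∀ (X : Type) [AddCommGroup X] [Module ℤ[T;T⁻¹] X] (c : D.Node → X), D.IsColoring c →
    ∃ c' : D'.Node → X, D'.IsColoring c' ∧ ∀ i, c' (q i) = c (p i)

/-- Every coloring of `D` is determined by the colors of the nodes `p i`. -/
def ColoringDetermined (D : GaussDiagram μ) {ι : Type} (p : ι → D.Node) : Prop :=
  ∀ (X : Type) [AddCommGroup X] [Module ℤ[T;T⁻¹] X] (c c' : D.Node → X), D.IsColoring c →
    D.IsColoring c' → (∀ i, c (p i) = c' (p i)) → c = c'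

theorem coloringDetermined_of_surjective {D : GaussDiagram μ} {ι : Type} {p : ι → D.Node}
    (hp : Function.Surjective p) : D.ColoringDetermined p := fun _ _ _ _ _ _ _ h =>
  funext <| hp.forall.2 h

end GaussDiagram

/-! ### The reduced Alexander module is the universal coloring -/

/-- `(t_i - 1) ⊗ 1`. -/
def eTau {μ : ℕ} (i : Fin μ) : ℤ[T;T⁻¹] ⊗[LaurentRing μ] augIdeal μ := 1 ⊗ₜ tvarSubOne i

/-- Across the tensor product, $t-1$ may be traded for $t_k-1$ with any $k$. Choosing the index
crosswise, both $(t-1)e_i$ and $(t-1)e_j$ become $(t_i-1)(t_j-1)\otimes1$. -/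
theorem T_smul_eTau_sub {μ : ℕ} (i j : Fin μ) :
    (T 1 : ℤ[T;T⁻¹]) • (eTau i - eTau j) = eTau i - eTau j := by
  have key : ∀ k l : Fin μ, (T 1 - 1 : ℤ[T;T⁻¹]) • eTau l
      = (1 : ℤ[T;T⁻¹]) ⊗ₜ[LaurentRing μ] ((tvar k - 1 : LaurentRing μ) • tvarSubOne l) := by
    intro k l
    rw [← TensorProduct.smul_tmul, Algebra.smul_def, mul_one, eTau, TensorProduct.smul_tmul',
      smul_eq_mul, mul_one]
    congr 1
    change _ = tauHom μ _
    rw [map_sub, tauHom_tvar, map_one]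
  have h : (T 1 - 1 : ℤ[T;T⁻¹]) • eTau i = (T 1 - 1 : ℤ[T;T⁻¹]) • eTau j := by
    rw [key j i, key i j]
    congr 1
    apply Subtype.ext
    simp [tvarSubOne, mul_comm]
  have h2 : (T 1 - 1 : ℤ[T;T⁻¹]) • (eTau i - eTau j) = 0 := by rw [smul_sub, h, sub_self]
  calc (T 1 : ℤ[T;T⁻¹]) • (eTau i - eTau j)
      = (T 1 - 1 : ℤ[T;T⁻¹]) • (eTau i - eTau j) + (eTau i - eTau j) := by module
    _ = eTau i - eTau j := by rw [h2, zero_add]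

theorem twist_eTau {μ : ℕ} (s : ℤˣ) (i j : Fin μ) : twist s (eTau i) (eTau j) = eTau j :=
  twist_eq_of_fixed s (T_smul_eTau_sub j i)

namespace LinkDiagram

variable {μ ν : ℕ} (D : LinkDiagram μ)

/-- The generator of the reduced Alexander module given by the edge that leaves `x`. -/
def nodeGen (x : D.Node) : D.ReducedModule :=
  (1 : ℤ[T;T⁻¹]) ⊗ₜ[LaurentRing μ] D.gen (GaussDiagram.arcOf x)

theorem phiTau_nodeGen (x : D.Node) : D.phiTau (D.nodeGen x) = eTau (D.κ x) := by
  rw [phiTau, nodeGen, LinearMap.baseChange_tmul, crowell_gen]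
  rfl

theorem gen_relation (k : D.Crossing) :
    (1 - tvar (D.arcκ (D.rightArc k))) • D.gen (D.overArc k)
      + tvar (D.arcκ (D.overArc k)) • D.gen (D.rightArc k) = D.gen (D.leftArc k) := by
  have h : D.gammaD (D.rhoD (Finsupp.single k 1)) = 0 := by
    rw [gammaD, Submodule.mkQ_apply, Submodule.Quotient.mk_eq_zero]
    exact ⟨_, rfl⟩
  simp only [rhoD, Finsupp.linearCombination_single, one_smul, map_sub, map_add, map_smul,
    sub_eq_zero] at h
  exact h

theorem isColoring_nodeGen : D.IsColoring D.nodeGen where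
  step y hy := by
    have : (GaussDiagram.arcOf (D.next.symm y) : D.Arc) = GaussDiagram.arcOf y :=
      Quot.sound ⟨by simp, hy⟩
    rw [nodeGen, nodeGen, this]
  cross k := by
    have h := congrArg (fun z => (1 : ℤ[T;T⁻¹]) ⊗ₜ[LaurentRing μ] z) (D.gen_relation k)
    simp only [TensorProduct.tmul_add, one_tmul_smul, map_sub, map_one, tauHom_tvar] at h
    rcases Int.units_eq_one_or (D.sign k) with hs | hs
    · simp only [GaussDiagram.rightArc, GaussDiagram.leftArc, hs, if_true] at h
      rw [hs, twist, Units.val_one, nodeGen, ← h, add_comm]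
      rfl
    · have hne : (-1 : ℤˣ) ≠ 1 := by decide
      simp only [GaussDiagram.rightArc, GaussDiagram.leftArc, hs, if_neg hne] at h
      -- At a negative crossing the right-hand arc is the outgoing one, so the relation gives the
      -- incoming color in terms of the outgoing color. It must be inverted.
      apply twist_left_injective 1 (D.nodeGen (D.overNode k))
      rw [hs, twist_twist_neg, twist, Units.val_one, add_comm]
      exact h

theorem span_nodeGen : Submodule.span ℤ[T;T⁻¹] (Set.range D.nodeGen) = ⊤ := by
  rw [eq_top_iff]
  rintro z -
  induction z using TensorProduct.induction_on with
  | zero => exact zero_mem _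
  | add x y hx hy => exact add_mem hx hy
  | tmul l m =>
    have h1 : (1 : ℤ[T;T⁻¹]) ⊗ₜ[LaurentRing μ] m ∈
        Submodule.span ℤ[T;T⁻¹] (Set.range D.nodeGen) := by
      obtain ⟨m, rfl⟩ := Submodule.mkQ_surjective _ m
      induction m using Finsupp.induction_linear with
      | zero => simp
      | add f g hf hg => rw [map_add, TensorProduct.tmul_add]; exact add_mem hf hg
      | single a r =>
        obtain ⟨x, rfl⟩ : ∃ x : D.Node, GaussDiagram.arcOf x = a := Quot.exists_rep a
        have : Finsupp.single (GaussDiagram.arcOf x) r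
            = r • Finsupp.single (GaussDiagram.arcOf x) 1 := by simp
        rw [this, map_smul, one_tmul_smul]
        exact Submodule.smul_mem _ _ (Submodule.subset_span ⟨x, rfl⟩)
    have : l ⊗ₜ[LaurentRing μ] m = l • ((1 : ℤ[T;T⁻¹]) ⊗ₜ[LaurentRing μ] m) := by
      rw [TensorProduct.smul_tmul', smul_eq_mul, mul_one]
    rw [this]
    exact Submodule.smul_mem _ _ h1

theorem linearMap_ext {X : Type} [AddCommGroup X] [Module ℤ[T;T⁻¹] X]
    {f g : D.ReducedModule →ₗ[ℤ[T;T⁻¹]] X} (h : ∀ x, f (D.nodeGen x) = g (D.nodeGen x)) : f = g :=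
  LinearMap.ext_on_range D.span_nodeGen h

theorem exists_lift {X : Type} [AddCommGroup X] [Module ℤ[T;T⁻¹] X] {c : D.Node → X}
    (hc : D.IsColoring c) :
    ∃ f : D.ReducedModule →ₗ[ℤ[T;T⁻¹]] X, ∀ x, f (D.nodeGen x) = c x := by
  -- Through $\tau$, `X` is a $\Lambda_\mu$-module, and a $\Lambda_\mu$-linear map out of $M_A(L)$
  -- extends to the base change.
  let _ : Module (LaurentRing μ) X := Module.compHom X (tauHom μ)
  have hsmul : ∀ (r : LaurentRing μ) (x : X), r • x = tauHom μ r • x := fun _ _ => rfl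
  have : IsScalarTower (LaurentRing μ) ℤ[T;T⁻¹] X := ⟨fun r l x => by
    rw [hsmul, smul_smul, Algebra.smul_def]; rfl⟩
  let cA : D.Arc → X := Quot.lift c fun x y h => by
    rw [hc.step y h.2, h.1, Equiv.symm_apply_apply]
  have hcA : ∀ x : D.Node, cA (GaussDiagram.arcOf x) = c x := fun _ => rfl
  let F : (D.Arc →₀ LaurentRing μ) →ₗ[LaurentRing μ] X := Finsupp.linearCombination _ cA
  have hF : LinearMap.range D.rhoD ≤ LinearMap.ker F := by
    rw [LinearMap.range_le_ker_iff]
    refine Finsupp.lhom_ext' fun k => LinearMap.ext_ring ?_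
    simp only [rhoD, F, LinearMap.comp_apply, Finsupp.lsingle_apply,
      Finsupp.linearCombination_single, one_smul, map_add, map_sub, map_smul, hsmul, tauHom_tvar,
      map_one, LinearMap.zero_apply]
    rw [sub_eq_zero]
    rcases Int.units_eq_one_or (D.sign k) with hs | hs
    · have h := hc.cross k
      rw [hs, twist, Units.val_one] at h
      simp only [GaussDiagram.rightArc, GaussDiagram.leftArc, GaussDiagram.overArc, hs, if_true,
        hcA]
      rw [h, add_comm]
    · have hne : (-1 : ℤˣ) ≠ 1 := by decide
      have h := congrArg (twist 1 (c (D.overNode k))) (hc.cross k)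
      rw [hs, twist_twist_neg, twist, Units.val_one] at h
      simp only [GaussDiagram.rightArc, GaussDiagram.leftArc, GaussDiagram.overArc, hs, if_neg hne,
        hcA]
      rw [← h, add_comm]
  let G : D.AlexanderModule →ₗ[LaurentRing μ] X := (LinearMap.range D.rhoD).liftQ F hF
  refine ⟨LinearMap.liftBaseChange ℤ[T;T⁻¹] G, fun x => ?_⟩
  rw [nodeGen, LinearMap.liftBaseChange_tmul, one_smul]
  simp [G, gen, gammaD, F, hcA]

/-- The linear map given by a coloring. -/
def lift {X : Type} [AddCommGroup X] [Module ℤ[T;T⁻¹] X] {c : D.Node → X}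
    (hc : D.IsColoring c) : D.ReducedModule →ₗ[ℤ[T;T⁻¹]] X :=
  (D.exists_lift hc).choose

@[simp] theorem lift_nodeGen {X : Type} [AddCommGroup X] [Module ℤ[T;T⁻¹] X] {c : D.Node → X}
    (hc : D.IsColoring c) (x : D.Node) : D.lift hc (D.nodeGen x) = c x :=
  (D.exists_lift hc).choose_spec x

/-- The map $\phi_\tau$ is the lift of this coloring, so it can be compared with other maps node by
node. -/
theorem isColoring_eTau : D.IsColoring fun x => eTau (D.κ x) where
  step y _ := by
    rw [(D.κ_eq_iff (D.next.symm y) y).2 ⟨1, by simp⟩]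
  cross k := by
    rw [twist_eTau, (D.κ_eq_iff (D.next.symm (D.underNode k)) (D.underNode k)).2 ⟨1, by simp⟩]

variable {D} in
/-- Diagrams with corresponding colorings have isomorphic reduced Alexander modules. -/
theorem exists_equiv_of_transfer {D' : LinkDiagram ν} {ι : Type} {p : ι → D.Node}
    {q : ι → D'.Node} (hp : D.ColoringDetermined p) (hq : D'.ColoringDetermined q)
    (h : D.ColoringTransfer D'.toGaussDiagram p q)
    (h' : D'.ColoringTransfer D.toGaussDiagram q p) :
    ∃ f : D.ReducedModule ≃ₗ[ℤ[T;T⁻¹]] D'.ReducedModule,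
      ∀ i, f (D.nodeGen (p i)) = D'.nodeGen (q i) := by
  -- A Yoneda argument: each universal coloring is transferred to the other diagram and lifted. Both
  -- composites fix the generators at the determining nodes, hence all generators.
  obtain ⟨c', hc', e'⟩ := h _ _ D.isColoring_nodeGen
  obtain ⟨c, hc, e⟩ := h' _ _ D'.isColoring_nodeGen
  refine ⟨LinearEquiv.ofLinearMap (D.lift hc) (D'.lift hc') ?_ ?_, fun i => ?_⟩
  · refine D'.linearMap_ext fun x => ?_
    have := hq _ _ _ (hc'.map (D.lift hc)) D'.isColoring_nodeGen fun i => by simp [e', e]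
    simpa using congrFun this x
  · refine D.linearMap_ext fun x => ?_
    have := hp _ _ _ (hc.map (D'.lift hc')) D.isColoring_nodeGen fun i => by simp [e', e]
    simpa using congrFun this x
  · simp [e]

variable {D} in
-- Both $\phi_\tau$ and $\phi'_\tau\circ f$ are given by colorings of `D` in $I_\mu\otimes\Lambda$,
-- and these agree at the determining nodes because the indices match there.
theorem phiTauEquivalent_of_transfer {D' : LinkDiagram μ} {ι : Type} {p : ι → D.Node}
    {q : ι → D'.Node} (hp : D.ColoringDetermined p) (hq : D'.ColoringDetermined q)
    (h : D.ColoringTransfer D'.toGaussDiagram p q)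
    (h' : D'.ColoringTransfer D.toGaussDiagram q p) (hκ : ∀ i, D'.κ (q i) = D.κ (p i)) :
    D.PhiTauEquivalent D' := by
  obtain ⟨f, hf⟩ := exists_equiv_of_transfer hp hq h h'
  refine ⟨f, fun z => ?_⟩
  have key : D.phiTau = D'.phiTau ∘ₗ f.toLinearMap := D.linearMap_ext fun x => by
    have := hp _ _ _ D.isColoring_eTau
      (D.isColoring_nodeGen.map (D'.phiTau ∘ₗ f.toLinearMap)) fun i => by
        simp [hf, phiTau_nodeGen, hκ]
    rw [phiTau_nodeGen]
    exact congrFun this x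
  exact LinearMap.congr_fun key z

end LinkDiagram

/-! ### Colorings and elementary moves -/

namespace GaussDiagram

variable {μ : ℕ} {D D' : GaussDiagram μ}

theorem SameCurves.symm_next {e : D.Node ≃ D'.Node} (h : SameCurves D D' e) (x : D.Node) :
    D'.next.symm (e x) = e (D.next.symm x) := by
  rw [Equiv.symm_apply_eq, ← h.1, Equiv.apply_symm_apply]

theorem SameCurves.symm {e : D.Node ≃ D'.Node} (h : SameCurves D D' e) :
    SameCurves D' D e.symm := by
  refine ⟨fun x => ?_, fun x => ?_⟩
  · rw [Equiv.symm_apply_eq, h.1, Equiv.apply_symm_apply]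
  · rw [← h.2, Equiv.apply_symm_apply]

theorem CrossingsMatch.symm {e : D.Node ≃ D'.Node} {g : D.Crossing ≃ D'.Crossing}
    (h : CrossingsMatch D D' e g) : CrossingsMatch D' D e.symm g.symm := by
  intro k
  obtain ⟨k, rfl⟩ := g.surjective k
  simp [(h k).1, (h k).2.1, (h k).2.2]

theorem coloringTransfer_of_match {e : D.Node ≃ D'.Node} {g : D.Crossing ≃ D'.Crossing}
    (h : SameCurves D D' e) (h' : CrossingsMatch D D' e g) :
    D'.ColoringTransfer D e id := by
  refine fun X _ _ c hc => ⟨c ∘ e, ⟨fun y hy => ?_, fun k => ?_⟩, fun _ => rfl⟩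
  · rw [Function.comp, Function.comp, ← h.symm_next]
    refine hc.step _ fun k hk => ?_
    obtain ⟨k, rfl⟩ := g.surjective k
    exact hy k (e.injective ((h' k).2.1 ▸ hk))
  · have := hc.cross (g k)
    rwa [(h' k).1, (h' k).2.1, (h' k).2.2, h.symm_next] at this

theorem coloringTransfer_of_match' {e : D.Node ≃ D'.Node} {g : D.Crossing ≃ D'.Crossing}
    (h : SameCurves D D' e) (h' : CrossingsMatch D D' e g) :
    D.ColoringTransfer D' id e := by
  intro X _ _ c hc
  obtain ⟨c', h1, h2⟩ := coloringTransfer_of_match h.symm h'.symm X c hc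
  exact ⟨c', h1, fun i => by simpa using h2 (e i)⟩

end GaussDiagram

namespace LinkDiagram

open GaussDiagram

variable {μ : ℕ} {D D' : LinkDiagram μ}

theorem phiTauEquivalent_of_isIso (h : IsIso D.toGaussDiagram D'.toGaussDiagram) :
    D.PhiTauEquivalent D' := by
  obtain ⟨e, g, h, h'⟩ := h
  exact phiTauEquivalent_of_transfer (coloringDetermined_of_surjective Function.surjective_id)
    (coloringDetermined_of_surjective e.surjective) (coloringTransfer_of_match' h h')
    (coloringTransfer_of_match h h') h.2

end LinkDiagram

/-! ### Adding a vertex, and the first Reidemeister move -/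

namespace GaussDiagram

variable {μ : ℕ} {D D' : GaussDiagram μ}

/-- This ensures that an added vertex has a predecessor other than itself. -/
theorem next_ne_self_of_sameCycle {x y : D.Node} (h : D.κ x = D.κ y) (hne : x ≠ y) :
    D.next x ≠ x := by
  intro hx
  obtain ⟨n, hn⟩ := (D.κ_eq_iff x y).1 h
  exact hne (by rw [← hn, Equiv.Perm.zpow_apply_eq_self_of_apply_eq_self hx])

/-- The added vertex lies between two nodes `f p` and `f (next p)`. -/
theorem exists_retraction_of_addVertex {f : D.Node → D'.Node} {m : D'.Node}
    (hr : Set.range f = {m}ᶜ) (hinj : Function.Injective f) (hκ : ∀ x, D'.κ (f x) = D.κ x) :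
    ∃ r : D'.Node → D.Node, (∀ x, r (f x) = x) ∧ (∀ y, y ≠ m → f (r y) = y) ∧
      f (r m) = D'.next.symm m := by
  classical
  have hsurj : ∀ y, y ≠ m → ∃ x, f x = y := fun y hy => by
    have : y ∈ Set.range f := by rw [hr]; exact hy
    exact this
  have hf : ∀ x, f x ≠ m := fun x hx => by
    have : f x ∈ ({m} : Set D'.Node)ᶜ := hr ▸ Set.mem_range_self x
    exact this hx
  have hm : D'.next.symm m ≠ m := by
    obtain ⟨x, hx⟩ := D.κ_surjective (D'.κ m)
    intro h
    exact next_ne_self_of_sameCycle (D := D') (x := m) (y := f x) (by rw [hκ, hx])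
      (hf x).symm (by rw [Equiv.symm_apply_eq] at h; exact h.symm)
  obtain ⟨p, hp⟩ := hsurj _ hm
  choose r hr' using hsurj
  -- The edge leaving `m` is the second half of the old edge leaving `p`, so `m` is sent to `p`.
  refine ⟨fun y => if h : y = m then p else r y h, fun x => ?_, fun y hy => ?_, ?_⟩
  · simp only [dif_neg (hf x)]
    exact hinj (hr' _ _)
  · simp only [dif_neg hy]
    exact hr' _ _
  · simp only [dif_pos, hp]

end GaussDiagram

namespace LinkDiagram

open GaussDiagram

variable {μ : ℕ} {D D' : LinkDiagram μ}

/-- The new vertex is no underpass, so the two halves of the subdivided edge have equal colors, and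
the colorings of `D'` are the colorings of `D` composed with the retraction `r`. -/
theorem phiTauEquivalent_of_addVertex (h : AddVertex D.toGaussDiagram D'.toGaussDiagram) :
    D.PhiTauEquivalent D' := by
  obtain ⟨f, m, g, hinj, hr, hg, hκ, hnext⟩ := h
  obtain ⟨r, hrf, hfr, hfm⟩ := exists_retraction_of_addVertex hr hinj hκ
  have hf : ∀ x, f x ≠ m := fun x hx => by
    have : f x ∈ ({m} : Set D'.Node)ᶜ := hr ▸ Set.mem_range_self x
    exact this hx
  have hum : ∀ k, D'.underNode k ≠ m := fun k => by
    obtain ⟨k, rfl⟩ := g.surjective k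
    rw [(hg k).2.1]; exact hf _
  have hprev : ∀ x, r (D'.next.symm (f x)) = D.next.symm x := by
    intro x
    apply hinj
    have h := hnext (D.next.symm x)
    rw [Equiv.apply_symm_apply] at h
    split_ifs at h with h1
    · rw [h, Equiv.symm_apply_apply, hfm, ← h1, Equiv.symm_apply_apply]
    · rw [h, Equiv.symm_apply_apply, hrf]
  have hcol : ∀ {X : Type} [AddCommGroup X] [Module ℤ[T;T⁻¹] X] (c : D'.Node → X),
      D'.IsColoring c → ∀ y, c (f (r y)) = c y := by
    intro X _ _ c hc y
    by_cases hy : y = m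
    · rw [hy, hfm, ← hc.step m hum]
    · rw [hfr y hy]
  refine phiTauEquivalent_of_transfer (p := id) (q := f)
    (coloringDetermined_of_surjective Function.surjective_id) ?_ ?_ ?_ hκ
  · intro X _ _ c c' hc hc' h
    funext y
    rw [← hcol c hc, h, hcol c' hc']
  · refine fun X _ _ c hc => ⟨c ∘ r, ⟨fun y hy => ?_, fun k => ?_⟩, fun x => by simp [hrf]⟩
    · simp only [Function.comp]
      by_cases h : y = m
      · have : r (D'.next.symm m) = r m := by rw [← hfm, hrf]
        rw [h, this]
      · rw [← hfr y h, hprev, hrf]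
        refine hc.step _ fun k hk => hy (g k) ?_
        rw [(hg k).2.1, hk, hfr y h]
    · obtain ⟨k, rfl⟩ := g.surjective k
      simp only [Function.comp]
      rw [(hg k).1, (hg k).2.1, (hg k).2.2, hprev, hrf, hrf]
      exact hc.cross k
  · refine fun X _ _ c hc => ⟨c ∘ f, ⟨fun y hy => ?_, fun k => ?_⟩, fun x => rfl⟩
    · simp only [Function.comp]
      rw [← hprev, hcol c hc]
      refine hc.step _ fun k hk => ?_
      obtain ⟨k, rfl⟩ := g.surjective k
      exact hy k (hinj ((hg k).2.1 ▸ hk))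
    · have := hc.cross (g k)
      rw [(hg k).1, (hg k).2.1, (hg k).2.2] at this
      simp only [Function.comp]
      rw [this, ← hprev, hcol c hc]

/-- At a kink, the coloring condition says that the color does not change. -/
theorem phiTauEquivalent_of_reidemeister1
    (h : Reidemeister1 D.toGaussDiagram D'.toGaussDiagram) : D.PhiTauEquivalent D' := by
  obtain ⟨e, g, k, hS, hg, -, hr, hk⟩ := h
  have hgk : ∀ j, g j ≠ k := fun j hj => by
    have : g j ∈ ({k} : Set D'.Crossing)ᶜ := hr ▸ Set.mem_range_self j
    exact this hj
  have hsurj : ∀ j, j ≠ k → ∃ i, g i = j := fun j hj => by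
    have : j ∈ Set.range g := by rw [hr]; exact hj
    exact this
  refine phiTauEquivalent_of_transfer (p := id) (q := e)
    (coloringDetermined_of_surjective Function.surjective_id)
    (coloringDetermined_of_surjective e.surjective) ?_ ?_ hS.2
  · refine fun X _ _ c hc => ⟨c ∘ e.symm, ⟨fun y hy => ?_, fun j => ?_⟩, fun x => by simp⟩
    · obtain ⟨x, rfl⟩ := e.surjective y
      simp only [Function.comp, hS.symm_next, Equiv.symm_apply_apply]
      refine hc.step x fun i hi => hy (g i) ?_
      rw [(hg i).2.1, hi]
    · by_cases hj : j = k
      · subst hj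
        obtain ⟨o, ho⟩ := e.surjective (D'.overNode j)
        obtain ⟨u, hu⟩ := e.surjective (D'.underNode j)
        have hstep : c u = c (D.next.symm u) := hc.step u fun i hi => by
          apply hgk i
          apply D'.underNode_injective
          rw [(hg i).2.1, hi, hu]
        have hstep' : c o = c (D.next.symm o) := hc.step o fun i hi => by
          apply D'.overNode_ne_underNode j (g i)
          rw [(hg i).2.1, hi, ho]
        have hou : c o = c u := by
          rcases hk with hk | hk
          · rw [← ho, ← hu, ← hS.1, e.apply_eq_iff_eq] at hk
            rw [hstep, ← hk, Equiv.symm_apply_apply]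
          · rw [← ho, ← hu, ← hS.1, e.apply_eq_iff_eq] at hk
            rw [hstep', ← hk, Equiv.symm_apply_apply]
        simp only [Function.comp, ← ho, ← hu, hS.symm_next, Equiv.symm_apply_apply]
        rw [← hstep, hou, twist_self]
      · obtain ⟨i, rfl⟩ := hsurj j hj
        simp only [Function.comp, (hg i).1, (hg i).2.1, (hg i).2.2, hS.symm_next,
          Equiv.symm_apply_apply]
        exact hc.cross i
  · refine fun X _ _ c hc => ⟨c ∘ e, ⟨fun y hy => ?_, fun i => ?_⟩, fun x => rfl⟩
    · simp only [Function.comp, ← hS.symm_next]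
      by_cases hu : D'.underNode k = e y
      · rw [← hu]
        have hc' := hc.cross k
        -- If the overpass comes first, the incoming edge is the overpassing one. Otherwise the
        -- outgoing edge has the color of the overpassing one, and the incoming color is recovered
        -- by injectivity of `twist`.
        rcases hk with hk | hk
        · have : D'.next.symm (D'.underNode k) = D'.overNode k := by rw [← hk]; simp
          rw [this, twist_self] at hc'
          rw [this, hc']
        · have := hc.step (D'.overNode k) fun i hi => D'.overNode_ne_underNode k i hi.symm
          rw [← hk, Equiv.symm_apply_apply, hk] at this
          rw [this] at hc'
          apply twist_left_injective (D'.sign k) (c (D'.underNode k))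
          rw [twist_self, ← hc']
      · refine hc.step _ fun j hj => ?_
        obtain ⟨i, rfl⟩ := hsurj j fun h => hu (h ▸ hj)
        exact hy i (e.injective ((hg i).2.1 ▸ hj))
    · have := hc.cross (g i)
      rwa [(hg i).1, (hg i).2.1, (hg i).2.2, hS.symm_next] at this

end LinkDiagram

/-! ### The second Reidemeister move -/

namespace GaussDiagram

variable {μ : ℕ} {D D' : GaussDiagram μ}

theorem IsColoring.eq_of_next {X : Type} [AddCommGroup X] [Module ℤ[T;T⁻¹] X] {c : D.Node → X}
    (hc : D.IsColoring c) {x y : D.Node} (h : D.next x = y) (hy : ∀ k, D.underNode k ≠ y) :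
    c x = c y := by
  rw [hc.step y hy, ← h, Equiv.symm_apply_apply]

theorem IsColoring.eq_of_adjacent {X : Type} [AddCommGroup X] [Module ℤ[T;T⁻¹] X]
    {c : D.Node → X} (hc : D.IsColoring c) {x y : D.Node} (h : D.next x = y ∨ D.next y = x)
    (hx : ∀ k, D.underNode k ≠ x) (hy : ∀ k, D.underNode k ≠ y) : c x = c y := by
  rcases h with h | h
  · exact hc.eq_of_next h hy
  · exact (hc.eq_of_next h hx).symm

end GaussDiagram

namespace LinkDiagram

open GaussDiagram

variable {μ : ℕ} {D D' : LinkDiagram μ}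

/-- Removing two crossings `j` and `k` of opposite signs, at which one strand underpasses another
in succession, only affects the color of the edge between them. -/
theorem phiTauEquivalent_of_bigon {e : D.Node ≃ D'.Node} {g : D.Crossing → D'.Crossing}
    {j k : D'.Crossing} (hS : SameCurves D.toGaussDiagram D'.toGaussDiagram e)
    (hg : CrossingsMatch D.toGaussDiagram D'.toGaussDiagram e g) (hr : Set.range g = {j, k}ᶜ)
    (hs : D'.sign k = -D'.sign j)
    (ho : D'.next (D'.overNode j) = D'.overNode k ∨ D'.next (D'.overNode k) = D'.overNode j)
    (hu : D'.next (D'.underNode j) = D'.underNode k) : D.PhiTauEquivalent D' := by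
  classical
  have hgj : ∀ i, g i ≠ j ∧ g i ≠ k := fun i => by
    have : g i ∈ ({j, k} : Set D'.Crossing)ᶜ := hr ▸ Set.mem_range_self i
    simpa using this
  have hsurj : ∀ l, l ≠ j → l ≠ k → ∃ i, g i = l := fun l hj hk => by
    have : l ∈ Set.range g := by rw [hr]; simp [hj, hk]
    exact this
  have hjk : j ≠ k := by
    rintro rfl
    rcases Int.units_eq_one_or (D'.sign j) with h | h <;> rw [h] at hs <;> revert hs <;> decide
  have hjk' : D'.underNode j ≠ D'.underNode k := fun h => hjk (D'.underNode_injective h)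
  have hpj : D'.next.symm (D'.underNode j) ≠ D'.underNode j := fun h => by
    rw [Equiv.symm_apply_eq, hu] at h; exact hjk' h
  have hpk : D'.next.symm (D'.underNode k) = D'.underNode j := by rw [← hu]; simp
  have hpn : ∀ y, y ≠ D'.underNode k → D'.next.symm y ≠ D'.underNode j := fun y hy h => by
    rw [Equiv.symm_apply_eq, hu] at h; exact hy h
  obtain ⟨u, heu⟩ := e.surjective (D'.underNode j)
  obtain ⟨v, hev⟩ := e.surjective (D'.underNode k)
  obtain ⟨o, heo⟩ := e.surjective (D'.overNode j)
  obtain ⟨q, heq⟩ := e.surjective (D'.overNode k)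
  have hnu : ∀ i, D.underNode i ≠ u := fun i hi =>
    (hgj i).1 (D'.underNode_injective (by rw [(hg i).2.1, hi, heu]))
  have hnv : ∀ i, D.underNode i ≠ v := fun i hi =>
    (hgj i).2 (D'.underNode_injective (by rw [(hg i).2.1, hi, hev]))
  have hno : ∀ i, D.underNode i ≠ o := fun i hi =>
    D'.overNode_ne_underNode j (g i) (by rw [(hg i).2.1, hi, heo])
  have hnq : ∀ i, D.underNode i ≠ q := fun i hi =>
    D'.overNode_ne_underNode k (g i) (by rw [(hg i).2.1, hi, heq])
  have huv : D.next u = v := e.injective (by rw [hS.1, heu, hu, hev])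
  have hoq : D.next o = q ∨ D.next q = o := by
    rw [← e.apply_eq_iff_eq, ← e.apply_eq_iff_eq (x := D.next q), hS.1, hS.1, heo, heq]
    exact ho
  -- The node omitted from the comparison starts the edge between the two underpasses.
  refine phiTauEquivalent_of_transfer (ι := {x : D.Node // e x ≠ D'.underNode j})
    (p := Subtype.val) (q := fun x => e x) ?_ ?_ ?_ ?_ fun x => hS.2 x
  · intro X _ _ c c' hc hc' h
    funext x
    by_cases hx : e x = D'.underNode j
    · have hxu : x = u := e.injective (hx.trans heu.symm)
      rw [hxu, hc.step u hnu, hc'.step u hnu]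
      refine h ⟨_, ?_⟩
      rw [← hS.symm_next, heu]
      exact hpj
    · exact h ⟨x, hx⟩
  · intro X _ _ c c' hc hc' h
    have h' : ∀ y, y ≠ D'.underNode j → c y = c' y := fun y hy => by
      obtain ⟨x, rfl⟩ := e.surjective y
      exact h ⟨x, hy⟩
    funext y
    by_cases hy : y = D'.underNode j
    · rw [hy, hc.cross, hc'.cross, h' _ hpj, h' _ (D'.overNode_ne_underNode j j)]
    · exact h' y hy
  · intro X _ _ c hc
    refine ⟨fun y => if y = D'.underNode j then twist (D'.sign j) (c o) (c (D.next.symm u))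
      else c (e.symm y), ⟨fun y hy => ?_, fun l => ?_⟩, fun x => by simp [x.2]⟩
    · simp only [if_neg (hy j).symm, if_neg (hpn y (hy k).symm)]
      obtain ⟨x, rfl⟩ := e.surjective y
      rw [hS.symm_next, Equiv.symm_apply_apply, Equiv.symm_apply_apply]
      exact hc.step x fun i hi => hy (g i) (by rw [(hg i).2.1, hi])
    · by_cases hlk : l = k
      · subst hlk
        -- Without the crossings the strand has one color before and after the bigon; with them, the
        -- twist at `k` must undo the twist at `j`, as its sign is opposite.
        have hcuv : c v = c (D.next.symm u) := by
          rw [← hc.step u hnu, hc.eq_of_next huv hnv]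
        simp only [hpk, if_true, if_neg hjk'.symm, if_neg (D'.overNode_ne_underNode l j)]
        rw [← hev, ← heq, Equiv.symm_apply_apply, Equiv.symm_apply_apply,
          hc.eq_of_adjacent hoq hno hnq, hs, twist_neg_twist, hcuv]
      · have hl : D'.underNode l ≠ D'.underNode k := fun h => hlk (D'.underNode_injective h)
        simp only [if_neg (D'.overNode_ne_underNode l j), if_neg (hpn _ hl)]
        by_cases hlj : l = j
        · subst hlj
          simp only [if_true]
          rw [← heo, ← heu, hS.symm_next, Equiv.symm_apply_apply, Equiv.symm_apply_apply]
        · obtain ⟨i, rfl⟩ := hsurj l hlj hlk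
          rw [if_neg fun h => hlj (D'.underNode_injective h), (hg i).1, (hg i).2.1, (hg i).2.2,
            hS.symm_next, Equiv.symm_apply_apply, Equiv.symm_apply_apply, Equiv.symm_apply_apply]
          exact hc.cross i
  · intro X _ _ c hc
    have hcc : c (D'.underNode k) = c (D'.next.symm (D'.underNode j)) := by
      rw [hc.cross k, hpk, hc.cross j, hs, hc.eq_of_adjacent ho
        (fun i hi => D'.overNode_ne_underNode _ _ hi.symm)
        (fun i hi => D'.overNode_ne_underNode _ _ hi.symm), twist_neg_twist]
    refine ⟨fun x => if e x = D'.underNode j then c (D'.underNode k) else c (e x),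
      ⟨fun x hx => ?_, fun i => ?_⟩, fun x => by simp [x.2]⟩
    · simp only [← hS.symm_next]
      by_cases hxk : e x = D'.underNode k
      · rw [hxk, hpk, if_pos rfl, if_neg hjk'.symm]
      · rw [if_neg (hpn _ hxk)]
        split_ifs with hxj
        · rw [hcc, hxj]
        · refine hc.step _ fun l hl => ?_
          obtain ⟨i, rfl⟩ := hsurj l (fun h => hxj (h ▸ hl.symm)) (fun h => hxk (h ▸ hl.symm))
          exact hx i (e.injective ((hg i).2.1 ▸ hl))
    · simp only [← hS.symm_next, ← (hg i).1, ← (hg i).2.1, ← (hg i).2.2]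
      rw [if_neg fun h => (hgj i).1 (D'.underNode_injective h),
        if_neg (D'.overNode_ne_underNode _ _),
        if_neg (hpn _ fun h => (hgj i).2 (D'.underNode_injective h))]
      exact hc.cross (g i)

/-- For antiparallel strands the two crossings are exchanged, so that the underpasses come in the
required order; the overpasses then come in the reverse order. -/
theorem phiTauEquivalent_of_reidemeister2
    (h : Reidemeister2 D.toGaussDiagram D'.toGaussDiagram) : D.PhiTauEquivalent D' := by
  obtain ⟨e, g, j, k, hS, hg, -, hr, hs, ho, hu | hu⟩ := h
  · exact phiTauEquivalent_of_bigon hS hg hr (by rw [hs, neg_neg]) (Or.inl ho) hu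
  · exact phiTauEquivalent_of_bigon hS hg (by rw [hr, Set.pair_comm]) hs (Or.inr ho) hu

end LinkDiagram

/-! ### The third Reidemeister move -/

namespace GaussDiagram

variable {μ : ℕ} {D D' : GaussDiagram μ}

/-- The triangle of a third Reidemeister move, with crossings `a` (top over middle), `b` (top over
bottom) and `c` (middle over bottom). The middle strand passes `m₁` and then `m₂`, the first of
which belongs to `a` if `α` holds and to `c` otherwise; the bottom strand passes `b₁` and then
`b₂`, the first of which belongs to `b` if `β` holds and to `c` otherwise. -/
structure Triangle (D : GaussDiagram μ) (a b c : D.Crossing) (α β : Bool)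
    (m₁ m₂ b₁ b₂ : D.Node) : Prop where
  ne_ab : a ≠ b
  ne_ac : a ≠ c
  ne_bc : b ≠ c
  top : D.next (D.overNode a) = D.overNode b ∨ D.next (D.overNode b) = D.overNode a
  mid : D.next m₁ = m₂
  bot : D.next b₁ = b₂
  under_a : D.underNode a = cond α m₁ m₂
  over_c : D.overNode c = cond α m₂ m₁
  under_b : D.underNode b = cond β b₁ b₂
  under_c : D.underNode c = cond β b₂ b₁
  sign_b : D.sign b = if α = β then D.sign a else -D.sign a

namespace Triangle

variable {a b c : D.Crossing} {α β : Bool} {m₁ m₂ b₁ b₂ : D.Node}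

theorem node_ne (h : D.Triangle a b c α β m₁ m₂ b₁ b₂) :
    m₁ ≠ m₂ ∧ b₁ ≠ b₂ ∧ m₁ ≠ b₁ ∧ m₁ ≠ b₂ ∧ m₂ ≠ b₁ ∧ m₂ ≠ b₂ := by
  have h1 := D.overNode_ne_underNode c a
  have h2 := D.overNode_ne_underNode c b
  have h3 := D.overNode_ne_underNode c c
  have h4 := D.underNode_injective.ne h.ne_ab
  have h5 := D.underNode_injective.ne h.ne_ac
  have h6 := D.underNode_injective.ne h.ne_bc
  rw [h.over_c, h.under_a] at h1
  rw [h.over_c, h.under_b] at h2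
  rw [h.over_c, h.under_c] at h3
  rw [h.under_b, h.under_a] at h4
  rw [h.under_c, h.under_a] at h5
  rw [h.under_c, h.under_b] at h6
  cases α <;> cases β <;> simp only [cond_true, cond_false] at * <;> grind

theorem under_ne (h : D.Triangle a b c α β m₁ m₂ b₁ b₂) {k : D.Crossing} (ha : k ≠ a)
    (hb : k ≠ b) (hc : k ≠ c) : D.underNode k ≠ m₁ ∧ D.underNode k ≠ m₂ ∧
      D.underNode k ≠ b₁ ∧ D.underNode k ≠ b₂ := by
  have h1 := D.overNode_ne_underNode c k
  have h4 := D.underNode_injective.ne ha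
  have h5 := D.underNode_injective.ne hb
  have h6 := D.underNode_injective.ne hc
  rw [h.over_c] at h1
  rw [h.under_a] at h4
  rw [h.under_b] at h5
  rw [h.under_c] at h6
  cases α <;> cases β <;> simp only [cond_true, cond_false] at * <;> grind

theorem over_ne (h : D.Triangle a b c α β m₁ m₂ b₁ b₂) {k : D.Crossing}
    (hc : k ≠ c) : D.overNode k ≠ m₁ ∧ D.overNode k ≠ m₂ ∧
      D.overNode k ≠ b₁ ∧ D.overNode k ≠ b₂ := by
  have h1 := D.overNode_ne_underNode k a
  have h4 := D.overNode_ne_underNode k b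
  have h5 := D.overNode_ne_underNode k c
  have h6 := D.overNode_injective.ne hc
  rw [h.under_a] at h1
  rw [h.under_b] at h4
  rw [h.under_c] at h5
  rw [h.over_c] at h6
  cases α <;> cases β <;> simp only [cond_true, cond_false] at * <;> grind

theorem prev_m (h : D.Triangle a b c α β m₁ m₂ b₁ b₂) : D.next.symm m₂ = m₁ := by
  rw [← h.mid, Equiv.symm_apply_apply]

theorem prev_b (h : D.Triangle a b c α β m₁ m₂ b₁ b₂) : D.next.symm b₂ = b₁ := by
  rw [← h.bot, Equiv.symm_apply_apply]

theorem prev_ne (h : D.Triangle a b c α β m₁ m₂ b₁ b₂) {x : D.Node} (hm : x ≠ m₂) (hb : x ≠ b₂) :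
    D.next.symm x ≠ m₁ ∧ D.next.symm x ≠ b₁ := by
  constructor <;> intro hx <;> rw [Equiv.symm_apply_eq] at hx
  · exact hm (hx.trans h.mid)
  · exact hb (hx.trans h.bot)

section Coloring

variable {X : Type} [AddCommGroup X] [Module ℤ[T;T⁻¹] X] {f : D.Node → X}

theorem color_top (h : D.Triangle a b c α β m₁ m₂ b₁ b₂) (hf : D.IsColoring f) :
    f (D.overNode a) = f (D.overNode b) :=
  hf.eq_of_adjacent h.top (fun _ hi => D.overNode_ne_underNode _ _ hi.symm)
    (fun _ hi => D.overNode_ne_underNode _ _ hi.symm)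

theorem color_m₁ (h : D.Triangle a b c α β m₁ m₂ b₁ b₂) (hf : D.IsColoring f) :
    f m₁ = cond α (twist (D.sign a) (f (D.overNode a)) (f (D.next.symm m₁)))
      (f (D.next.symm m₁)) := by
  cases α
  · exact hf.step m₁ fun k hk => D.overNode_ne_underNode c k (h.over_c.trans hk.symm)
  · have := hf.cross a
    rwa [h.under_a] at this

/-- Of its two corners, the middle strand underpasses only at `a`, so its outgoing color does not
depend on the order `α`. -/
theorem color_m₂ (h : D.Triangle a b c α β m₁ m₂ b₁ b₂) (hf : D.IsColoring f) :
    f m₂ = twist (D.sign a) (f (D.overNode a)) (f (D.next.symm m₁)) := by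
  have h1 := h.color_m₁ hf
  cases α
  · have := hf.cross a
    rw [h.under_a, cond_false, h.prev_m, h1] at this
    exact this
  · rw [hf.step m₂ fun k hk => D.overNode_ne_underNode c k (h.over_c.trans hk.symm), h.prev_m, h1,
      cond_true]

theorem color_b₁ (h : D.Triangle a b c α β m₁ m₂ b₁ b₂) (hf : D.IsColoring f) :
    f b₁ = cond β (twist (D.sign b) (f (D.overNode a)) (f (D.next.symm b₁)))
      (twist (D.sign c) (f (D.overNode c)) (f (D.next.symm b₁))) := by
  have hb := hf.cross b
  have hc := hf.cross c
  cases β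
  · rwa [h.under_c] at hc
  · rwa [h.under_b, ← h.color_top hf] at hb

theorem color_b₂ (h : D.Triangle a b c α β m₁ m₂ b₁ b₂) (hf : D.IsColoring f) :
    f b₂ = cond β (twist (D.sign c) (f (D.overNode c)) (f b₁))
      (twist (D.sign b) (f (D.overNode a)) (f b₁)) := by
  have hb := hf.cross b
  have hc := hf.cross c
  cases β
  · rwa [h.under_b, cond_false, h.prev_b, ← h.color_top hf] at hb
  · rwa [h.under_c, cond_true, h.prev_b] at hc

end Coloring

/-- The colors at `m₁` and `b₁` follow from the others; `m₁` is treated before `b₁`, because the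
overpassing strand at `c` may be the edge leaving `m₁`. -/
theorem coloringDetermined (h : D.Triangle a b c α β m₁ m₂ b₁ b₂) :
    D.ColoringDetermined (Subtype.val : {x : D.Node // x ≠ m₁ ∧ x ≠ b₁} → D.Node) := by
  intro X _ _ f f' hf hf' he
  have he' : ∀ x, x ≠ m₁ → x ≠ b₁ → f x = f' x := fun x h1 h2 => he ⟨x, h1, h2⟩
  obtain ⟨n1, n2, n3, n4, n5, n6⟩ := h.node_ne
  have ho := h.over_ne h.ne_ac
  have hm := h.prev_ne n1 n4
  have hb := h.prev_ne n5.symm n2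
  have hm₁ : f m₁ = f' m₁ := by
    rw [h.color_m₁ hf, h.color_m₁ hf', he' _ ho.1 ho.2.2.1, he' _ hm.1 hm.2]
  have hoc : f (D.overNode c) = f' (D.overNode c) := by
    rw [h.over_c]
    cases α
    · exact hm₁
    · exact he' _ n1.symm n5
  funext x
  by_cases h1 : x = m₁
  · rw [h1, hm₁]
  by_cases h2 : x = b₁
  · rw [h2, h.color_b₁ hf, h.color_b₁ hf', he' _ ho.1 ho.2.2.1, he' _ hb.1 hb.2, hoc]
  exact he' x h1 h2

/-- The move changes the colors of the edges that leave `m₁` and `b₁`, and no others. -/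
theorem exists_coloring {e : D.Node ≃ D'.Node} {g : D.Crossing ≃ D'.Crossing}
    (hS : SameCurves D D' e) (h : D.Triangle a b c α β m₁ m₂ b₁ b₂)
    (h' : D'.Triangle (g a) (g b) (g c) (!α) (!β) (e m₁) (e m₂) (e b₁) (e b₂))
    (hoa : D'.overNode (g a) = e (D.overNode b)) (hob : D'.overNode (g b) = e (D.overNode a))
    (hsign : ∀ k, D'.sign (g k) = D.sign k)
    (hg : ∀ k, k ≠ a → k ≠ b → k ≠ c →
      D'.overNode (g k) = e (D.overNode k) ∧ D'.underNode (g k) = e (D.underNode k))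
    {X : Type} [AddCommGroup X] [Module ℤ[T;T⁻¹] X] {f : D.Node → X} (hf : D.IsColoring f) :
    ∃ f' : D'.Node → X, D'.IsColoring f' ∧ ∀ x, x ≠ m₁ → x ≠ b₁ → f' (e x) = f x := by
  classical
  obtain ⟨n1, n2, n3, n4, n5, n6⟩ := h.node_ne
  have hpm := h.prev_ne n1 n4
  have hpb := h.prev_ne n5.symm n2
  have hA := h.over_ne h.ne_ac
  have hB := h.over_ne h.ne_bc
  have cm₁ := h.color_m₁ hf
  have cm₂ := h.color_m₂ hf
  have cb₁ := h.color_b₁ hf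
  have cb₂ := h.color_b₂ hf
  have ctop := h.color_top hf
  have hsb := h.sign_b
  have hoc := h.over_c
  -- The new inner colors `m'` and `b'` are computed with the corners in reversed order. If `a` came
  -- first, the inner edge of the middle strand now has the incoming color; otherwise it has the
  -- outgoing one.
  set m' : X := cond α (f (D.next.symm m₁)) (f m₂) with hm'
  set b' : X := cond β (twist (D.sign c) m' (f (D.next.symm b₁)))
    (twist (D.sign b) (f (D.overNode a)) (f (D.next.symm b₁))) with hb'
  obtain ⟨F, hF⟩ : ∃ F : D.Node → X,
      F = fun x => if x = m₁ then m' else if x = b₁ then b' else f x := ⟨_, rfl⟩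
  have Fm : F m₁ = m' := by simp [hF]
  have Fb : F b₁ = b' := by simp [hF, n3.symm]
  have F0 : ∀ x, x ≠ m₁ → x ≠ b₁ → F x = f x := fun x h1 h2 => by simp [hF, h1, h2]
  have Fpm := F0 _ hpm.1 hpm.2
  have Fpb := F0 _ hpb.1 hpb.2
  have Fm₂ := F0 _ n1.symm n5
  have Fb₂ := F0 _ n4.symm n2.symm
  have Fa := F0 _ hA.1 hA.2.2.1
  have Fbb := F0 _ hB.1 hB.2.2.1
  -- The color of the middle strand at the crossing `g c`.
  have Foc : F (cond α m₁ m₂) = m' := by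
    cases α
    · rw [cond_false, Fm₂, hm', cond_false]
    · exact Fm
  -- The bottom strand must leave with its old color. Passing under the top and the middle strand in
  -- either order gives the same result by `twist_twist`, since the colors of the middle strand at
  -- `c` before and after the move differ by a twist by the top strand. The condition `sign_b` gives
  -- this twist the sign of `b`.
  have hbot : f b₂ = cond β (twist (D.sign b) (f (D.overNode a)) b')
      (twist (D.sign c) m' b') := by
    cases β
    · have hmid : m' = twist (D.sign b) (f (D.overNode a)) (f (D.overNode c)) := by
        rw [hm', hoc, hsb]
        cases α
        · simp only [cond_false, if_true, cm₁, cm₂]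
        · simp only [cond_true, reduceCtorEq, if_false, cm₂, twist_neg_twist]
      simp only [cond_false] at cb₁ cb₂ hb' ⊢
      rw [cb₂, cb₁, hb', hmid, twist_twist]
    · have hmid : f (D.overNode c) = twist (D.sign b) (f (D.overNode a)) m' := by
        rw [hm', hoc, hsb]
        cases α
        · simp only [cond_false, reduceCtorEq, if_false, cm₁, cm₂, twist_neg_twist]
        · simp only [cond_true, if_true, cm₂]
      simp only [cond_true] at cb₁ cb₂ hb' ⊢
      rw [cb₂, cb₁, hb', hmid, ← twist_twist]
  refine ⟨F ∘ e.symm, ⟨fun y hy => ?_, fun k => ?_⟩, fun x h1 h2 => by simp [F0 x h1 h2]⟩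
  · obtain ⟨x, rfl⟩ := e.surjective y
    simp only [Function.comp, hS.symm_next, Equiv.symm_apply_apply]
    have hxa := h'.under_a ▸ hy (g a)
    have hxb := h'.under_b ▸ hy (g b)
    have hxc := h'.under_c ▸ hy (g c)
    have hxb₁ : x ≠ b₁ := by rintro rfl; cases β <;> simp at hxb hxc
    have hxb₂ : x ≠ b₂ := by rintro rfl; cases β <;> simp at hxb hxc
    by_cases hx₁ : x = m₁
    · subst hx₁
      cases α
      · simp at hxa
      · rw [Fm, Fpm, hm', cond_true]
    by_cases hx₂ : x = m₂
    · subst hx₂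
      cases α
      · rw [h.prev_m, Fm, Fm₂, hm', cond_false]
      · simp at hxa
    have hp := h.prev_ne hx₂ hxb₂
    rw [F0 x hx₁ hxb₁, F0 _ hp.1 hp.2]
    refine hf.step x fun k hk => ?_
    have hka : k ≠ a := by
      rintro rfl
      have := h.under_a
      cases α
      · exact hx₂ (hk.symm.trans this)
      · exact hx₁ (hk.symm.trans this)
    have hkb : k ≠ b := by
      rintro rfl
      have := h.under_b
      cases β
      · exact hxb₂ (hk.symm.trans this)
      · exact hxb₁ (hk.symm.trans this)
    have hkc : k ≠ c := by
      rintro rfl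
      have := h.under_c
      cases β
      · exact hxb₁ (hk.symm.trans this)
      · exact hxb₂ (hk.symm.trans this)
    exact hy (g k) (by rw [(hg k hka hkb hkc).2, hk])
  · obtain ⟨k, rfl⟩ := g.surjective k
    simp only [Function.comp, hsign]
    by_cases hka : k = a
    · subst hka
      rw [h'.under_a, hoa]
      cases α <;> simp only [Bool.not_true, Bool.not_false, cond_true, cond_false, hS.symm_next,
        Equiv.symm_apply_apply]
      · rw [Fm, Fbb, Fpm, ← ctop, ← cm₂, hm', cond_false]
      · rw [Fm₂, Fbb, h.prev_m, Fm, ← ctop, cm₂, hm', cond_true]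
    by_cases hkb : k = b
    · subst hkb
      rw [h'.under_b, hob]
      cases β <;> simp only [Bool.not_true, Bool.not_false, cond_true, cond_false, hS.symm_next,
        Equiv.symm_apply_apply]
      · rw [Fb, Fa, Fpb, hb', cond_false]
      · rw [Fb₂, Fa, h.prev_b, Fb, hbot, cond_true]
    by_cases hkc : k = c
    · subst hkc
      have : e.symm (D'.overNode (g k)) = cond α m₁ m₂ := by
        rw [h'.over_c]; cases α <;> simp
      rw [h'.under_c, this, Foc]
      cases β <;> simp only [Bool.not_true, Bool.not_false, cond_true, cond_false, hS.symm_next,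
        Equiv.symm_apply_apply]
      · rw [Fb₂, h.prev_b, Fb, hbot, cond_false]
      · rw [Fb, Fpb, hb', cond_true]
    have hu := h.under_ne hka hkb hkc
    have ho := h.over_ne hkc
    have hp := h.prev_ne hu.2.1 hu.2.2.2
    rw [(hg k hka hkb hkc).1, (hg k hka hkb hkc).2, hS.symm_next, Equiv.symm_apply_apply,
      Equiv.symm_apply_apply, Equiv.symm_apply_apply, F0 _ hu.1 hu.2.2.1, F0 _ ho.1 ho.2.2.1,
      F0 _ hp.1 hp.2]
    exact hf.cross k

end Triangle

/-- The order of two consecutive nodes. -/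
theorem exists_of_consecutive {s : ℤˣ} {x y : D.Node} (h : D.Consecutive s x y) :
    ∃ (α : Bool) (p q : D.Node), (s = if α then 1 else -1) ∧ D.next p = q ∧ x = cond α p q ∧
      y = cond α q p := by
  rcases Int.units_eq_one_or s with rfl | rfl
  · exact ⟨true, x, y, by simp, by simpa [Consecutive] using h, rfl, rfl⟩
  · have hne : (-1 : ℤˣ) ≠ 1 := by decide
    rw [Consecutive, if_neg hne] at h
    exact ⟨false, y, x, by simp, h, rfl, rfl⟩

/-- The product of the two order signs is $(\delta c)(\delta abc)=ab$, so the orders agree exactly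
when $a=b$. -/
theorem sign_eq_of_orders {δ a b c : ℤˣ} {α β : Bool} (hα : δ * c = if α then 1 else -1)
    (hβ : δ * a * b * c = if β then 1 else -1) : b = if α = β then a else -a := by
  rcases Int.units_eq_one_or δ with rfl | rfl <;> rcases Int.units_eq_one_or a with rfl | rfl <;>
  rcases Int.units_eq_one_or b with rfl | rfl <;> rcases Int.units_eq_one_or c with rfl | rfl <;>
  cases α <;> cases β <;> revert hα hβ <;> decide

/-- The two triangles of a third Reidemeister move. -/
theorem Reidemeister3.exists_triangle (h : Reidemeister3 D D') :
    ∃ (e : D.Node ≃ D'.Node) (g : D.Crossing ≃ D'.Crossing) (a b c : D.Crossing) (α β : Bool)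
      (m₁ m₂ b₁ b₂ : D.Node), SameCurves D D' e ∧ D.Triangle a b c α β m₁ m₂ b₁ b₂ ∧
      D'.Triangle (g a) (g b) (g c) (!α) (!β) (e m₁) (e m₂) (e b₁) (e b₂) ∧
      D'.overNode (g a) = e (D.overNode b) ∧ D'.overNode (g b) = e (D.overNode a) ∧
      (∀ k, D'.sign (g k) = D.sign k) ∧ ∀ k, k ≠ a → k ≠ b → k ≠ c →
        D'.overNode (g k) = e (D.overNode k) ∧ D'.underNode (g k) = e (D.underNode k) := by
  classical
  obtain ⟨e, g, a, b, c, δ, hS, hab, hac, hbc, htop, hmid, hbot, hg⟩ := h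
  have htop' : D.next (D.overNode a) = D.overNode b ∨ D.next (D.overNode b) = D.overNode a := by
    unfold Consecutive at htop
    split_ifs at htop
    exacts [Or.inl htop, Or.inr htop]
  obtain ⟨α, m₁, m₂, hα, hm, hua, hoc⟩ := exists_of_consecutive hmid
  obtain ⟨β, b₁, b₂, hβ, hb, hub, huc⟩ := exists_of_consecutive hbot
  have hsign := sign_eq_of_orders hα hβ
  have noo : ∀ {j k}, j ≠ k → D.overNode j ≠ D.overNode k := D.overNode_injective.ne
  have nuu : ∀ {j k}, j ≠ k → D.underNode j ≠ D.underNode k := D.underNode_injective.ne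
  have nou := D.overNode_ne_underNode
  have nuo : ∀ j k, D.underNode j ≠ D.overNode k := fun j k => (nou k j).symm
  -- The three transpositions act on disjoint pairs of nodes. Evaluating them at the six corner
  -- nodes shows which node each crossing takes over.
  have hga := hg a
  have hgb := hg b
  have hgc := hg c
  simp only [Equiv.swap_apply_of_ne_of_ne (nou a b) (nou a c),
    Equiv.swap_apply_of_ne_of_ne (nou a a) (noo hac), Equiv.swap_apply_left,
    Equiv.swap_apply_of_ne_of_ne (nuu hab) (nuu hac),
    Equiv.swap_apply_of_ne_of_ne (noo hac.symm) (noo hbc.symm)] at hga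
  simp only [Equiv.swap_apply_of_ne_of_ne (nou b b) (nou b c),
    Equiv.swap_apply_of_ne_of_ne (nou b a) (noo hbc), Equiv.swap_apply_left,
    Equiv.swap_apply_right, Equiv.swap_apply_of_ne_of_ne (nuu hac.symm) (nuo c c),
    Equiv.swap_apply_of_ne_of_ne (nuo c a) (nuo c b)] at hgb
  simp only [Equiv.swap_apply_of_ne_of_ne (nou c b) (nou c c), Equiv.swap_apply_right,
    Equiv.swap_apply_of_ne_of_ne (nuo a a) (nuo a b),
    Equiv.swap_apply_of_ne_of_ne (nuu hab.symm) (nuo b c),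
    Equiv.swap_apply_of_ne_of_ne (nuo b a) (nuo b b)] at hgc
  refine ⟨e, g, a, b, c, α, β, m₁, m₂, b₁, b₂, hS,
    ⟨hab, hac, hbc, htop', hm, hb, hua, hoc, hub, huc, hsign⟩,
    ⟨g.injective.ne hab, g.injective.ne hac, g.injective.ne hbc, ?_, ?_, ?_, ?_, ?_, ?_, ?_, ?_⟩,
    hga.1, hgb.1, fun k => (hg k).2.2, fun k ka kb kc => ?_⟩
  · rw [hga.1, hgb.1, ← hS.1, ← hS.1, e.apply_eq_iff_eq, e.apply_eq_iff_eq]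
    exact htop'.symm
  · rw [← hS.1, hm]
  · rw [← hS.1, hb]
  · rw [hga.2.1, hoc]; cases α <;> rfl
  · rw [hgc.1, hua]; cases α <;> rfl
  · rw [hgb.2.1, huc]; cases β <;> rfl
  · rw [hgc.2.1, hub]; cases β <;> rfl
  · rw [hga.2.2, hgb.2.2, hsign]; cases α <;> cases β <;> rfl
  · have := hg k
    simp only [Equiv.swap_apply_of_ne_of_ne (nou k b) (nou k c),
      Equiv.swap_apply_of_ne_of_ne (nou k a) (noo kc),
      Equiv.swap_apply_of_ne_of_ne (noo ka) (noo kb),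
      Equiv.swap_apply_of_ne_of_ne (nuu kb) (nuu kc),
      Equiv.swap_apply_of_ne_of_ne (nuu ka) (nuo k c),
      Equiv.swap_apply_of_ne_of_ne (nuo k a) (nuo k b)] at this
    exact ⟨this.1, this.2.1⟩

end GaussDiagram

namespace LinkDiagram

open GaussDiagram

variable {μ : ℕ} {D D' : LinkDiagram μ}

theorem phiTauEquivalent_of_reidemeister3
    (h : Reidemeister3 D.toGaussDiagram D'.toGaussDiagram) : D.PhiTauEquivalent D' := by
  obtain ⟨e, g, a, b, c, α, β, m₁, m₂, b₁, b₂, hS, h, h', hoa, hob, hsign, hg⟩ :=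
    h.exists_triangle
  refine phiTauEquivalent_of_transfer (ι := {x : D.Node // x ≠ m₁ ∧ x ≠ b₁})
    (p := Subtype.val) (q := fun x => e x) h.coloringDetermined ?_ ?_ ?_ fun x => hS.2 x
  · intro X _ _ f f' hf hf' he
    refine h'.coloringDetermined X f f' hf hf' fun y => ?_
    have := he ⟨e.symm y, fun hy => y.2.1 (e.symm_apply_eq.1 hy),
      fun hy => y.2.2 (e.symm_apply_eq.1 hy)⟩
    simpa using this
  · intro X _ _ f hf
    obtain ⟨f', hf', he⟩ := h.exists_coloring hS h' hoa hob hsign hg hf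
    exact ⟨f', hf', fun x => he x x.2.1 x.2.2⟩
  · intro X _ _ f hf
    -- Reversing both orders twice restores them, so the inverse move has the same form.
    obtain ⟨f', hf', he⟩ := h'.exists_coloring (g := g.symm) hS.symm (by simpa using h)
      (by simp [hob]) (by simp [hoa]) (fun k => by simp [← hsign])
      (fun k ka kb kc => by
        obtain ⟨k, rfl⟩ := g.surjective k
        simp [hg k (fun h => ka (h ▸ rfl)) (fun h => kb (h ▸ rfl)) (fun h => kc (h ▸ rfl))]) hf
    refine ⟨f', hf', fun x => ?_⟩
    simpa using he (e x) (e.injective.ne x.2.1) (e.injective.ne x.2.2)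

/-! ### Invariance under link equivalence -/

theorem PhiTauEquivalent.refl (D : LinkDiagram μ) : D.PhiTauEquivalent D :=
  ⟨LinearEquiv.refl _ _, fun _ => rfl⟩

theorem PhiTauEquivalent.symm (h : D.PhiTauEquivalent D') : D'.PhiTauEquivalent D := by
  obtain ⟨f, hf⟩ := h
  exact ⟨f.symm, fun x => by rw [hf, LinearEquiv.apply_symm_apply]⟩

theorem PhiTauEquivalent.trans {D'' : LinkDiagram μ} (h : D.PhiTauEquivalent D')
    (h' : D'.PhiTauEquivalent D'') : D.PhiTauEquivalent D'' := by
  obtain ⟨f, hf⟩ := h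
  obtain ⟨f', hf'⟩ := h'
  exact ⟨f.trans f', fun x => by rw [hf, hf', LinearEquiv.trans_apply]⟩

theorem Equivalent.phiTauEquivalent (h : D.Equivalent D') : D.PhiTauEquivalent D' := by
  induction h with
  | rel _ _ h =>
    rcases h with h | h | h | h | h
    exacts [phiTauEquivalent_of_isIso h, phiTauEquivalent_of_addVertex h,
      phiTauEquivalent_of_reidemeister1 h, phiTauEquivalent_of_reidemeister2 h,
      phiTauEquivalent_of_reidemeister3 h]
  | refl => exact PhiTauEquivalent.refl _
  | symm _ _ _ ih => exact ih.symm
  | trans _ _ _ _ _ ih ih' => exact ih.trans ih'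

end LinkDiagram

/-! ### Functionals on `I_μ ⊗ Λ` -/

/-- The augmentation map `Λ → ℤ`, `t ↦ 1`. -/
def evalOne : ℤ[T;T⁻¹] →+* ℤ := (AddMonoidAlgebra.lift ℤ ℤ ℤ 1 : ℤ[T;T⁻¹] →ₐ[ℤ] ℤ)

theorem evalOne_T (n : ℤ) : evalOne (T n) = 1 :=
  (AddMonoidAlgebra.lift_single _ _ _).trans (by simp)

theorem evalOne_tauHom {μ : ℕ} (r : LaurentRing μ) : evalOne (tauHom μ r) = augmentation μ r := by
  have : evalOne.comp (tauHom μ) = augmentation μ := by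
    refine AddMonoidAlgebra.ringHom_ext' (Subsingleton.elim _ _) (MonoidHom.ext fun m => ?_)
    simp [tauHom, augmentation, evalOne_T]
  exact RingHom.congr_fun this r

theorem smul_eq_evalOne_smul {X : Type} [AddCommGroup X] [Module ℤ[T;T⁻¹] X] {v : X}
    (h : (T 1 : ℤ[T;T⁻¹]) • v = v) (l : ℤ[T;T⁻¹]) : l • v = evalOne l • v := by
  induction l using LaurentPolynomial.induction_on' with
  | add p q hp hq => rw [add_smul, hp, hq, map_add, add_smul]
  | C_mul_T n a =>
    rw [mul_smul, T_smul_eq_of_fixed h, map_mul, evalOne_T, mul_one, eq_intCast C a, map_intCast,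
      Int.cast_smul_eq_zsmul]
    rfl

/-- The first-order Taylor expansion `f ↦ f(1) + ∂f/∂t_j (1) ε`. -/
def taylorHom {μ : ℕ} (j : Fin μ) : LaurentRing μ →+* DualNumber ℤ :=
  (AddMonoidAlgebra.lift ℤ (DualNumber ℤ) (Fin μ →₀ ℤ)
    { toFun := fun m => 1 + TrivSqZeroExt.inr (m.toAdd j)
      map_one' := by simp
      map_mul' := fun m n => by
        ext <;> simp [add_comm] } : LaurentRing μ →ₐ[ℤ] DualNumber ℤ)

theorem fst_taylorHom {μ : ℕ} (j : Fin μ) (r : LaurentRing μ) :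
    (taylorHom j r).fst = augmentation μ r := by
  have : ((TrivSqZeroExt.fstHom ℤ ℤ ℤ : DualNumber ℤ →ₐ[ℤ] ℤ) : DualNumber ℤ →+* ℤ).comp
      (taylorHom j) = augmentation μ := by
    refine AddMonoidAlgebra.ringHom_ext' (Subsingleton.elim _ _) (MonoidHom.ext fun m => ?_)
    simp [taylorHom, augmentation]
  exact RingHom.congr_fun this r

theorem snd_taylorHom_tvarSubOne {μ : ℕ} (i j : Fin μ) :
    (taylorHom j (tvarSubOne i : LaurentRing μ)).snd = if i = j then 1 else 0 := by
  simp only [taylorHom, tvarSubOne, tvar, map_sub, map_one]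
  split_ifs with h <;> simp [h]

/-- `(f ⊗ λ) ↦ λ(1) ∂f/∂t_j (1)`. -/
def derivTau {μ : ℕ} (j : Fin μ) : ℤ[T;T⁻¹] ⊗[LaurentRing μ] augIdeal μ →+ ℤ :=
  TensorProduct.liftAddHom
    { toFun := fun l =>
        { toFun := fun f => evalOne l * (taylorHom j (f : LaurentRing μ)).snd
          map_zero' := by simp
          map_add' := fun f g => by simp [mul_add] }
      map_zero' := by ext; simp
      map_add' := fun l l' => by ext; simp [add_mul] }
    fun r l f => by
      -- As $f(1)=0$, the Leibniz rule leaves $\partial_j(rf)(1)=r(1)\,\partial_jf(1)$, which makes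
      -- the functional balanced over $\Lambda_\mu$.
      have hf : augmentation μ (f : LaurentRing μ) = 0 := f.2
      have h : evalOne (r • l) = augmentation μ r * evalOne l := by
        rw [Algebra.smul_def, map_mul, ← evalOne_tauHom]
        rfl
      simp only [AddMonoidHom.coe_mk, ZeroHom.coe_mk, Submodule.coe_smul, smul_eq_mul, map_mul, h,
        TrivSqZeroExt.snd_mul, fst_taylorHom, hf, MulOpposite.op_zero, zero_smul, add_zero]
      ring

theorem derivTau_eTau {μ : ℕ} (i j : Fin μ) : derivTau j (eTau i) = if i = j then 1 else 0 := by
  rw [← snd_taylorHom_tvarSubOne, eTau, derivTau, TensorProduct.liftAddHom_tmul]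
  simp

theorem derivTau_smul {μ : ℕ} (j : Fin μ) (l : ℤ[T;T⁻¹])
    (z : ℤ[T;T⁻¹] ⊗[LaurentRing μ] augIdeal μ) :
    derivTau j (l • z) = evalOne l * derivTau j z := by
  induction z using TensorProduct.induction_on with
  | zero => simp
  | add x y hx hy => rw [smul_add, map_add, map_add, hx, hy, mul_add]
  | tmul a f =>
    rw [TensorProduct.smul_tmul', derivTau, TensorProduct.liftAddHom_tmul,
      TensorProduct.liftAddHom_tmul]
    simp [mul_assoc]

theorem eTau_injective {μ : ℕ} : Function.Injective (eTau : Fin μ → _) := by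
  intro i j h
  have h' := derivTau_eTau i j
  rw [h, derivTau_eTau, if_pos rfl] at h'
  by_contra hij
  rw [if_neg hij] at h'
  exact one_ne_zero h'

/-- The linear map with `(t_i - 1) ⊗ 1 ↦ t - 1`. -/
def inclTau (μ : ℕ) : ℤ[T;T⁻¹] ⊗[LaurentRing μ] augIdeal μ →ₗ[ℤ[T;T⁻¹]] ℤ[T;T⁻¹] :=
  LinearMap.liftBaseChange ℤ[T;T⁻¹] (Algebra.linearMap (LaurentRing μ) ℤ[T;T⁻¹] ∘ₗ
    (augIdeal μ).subtype)

theorem inclTau_eTau {μ : ℕ} (i : Fin μ) : inclTau μ (eTau i) = T 1 - 1 := by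
  rw [eTau, inclTau, LinearMap.liftBaseChange_tmul, one_smul]
  change tauHom μ (tvar i - 1) = _
  rw [map_sub, tauHom_tvar, map_one]

theorem T_one_sub_one_ne_zero : (T 1 - 1 : ℤ[T;T⁻¹]) ≠ 0 := by
  intro h
  rw [sub_eq_zero, ← T_zero] at h
  exact one_ne_zero (AddMonoidAlgebra.single_left_injective (one_ne_zero (α := ℤ)) h)

namespace LinkDiagram

variable {μ ν : ℕ} (D : LinkDiagram μ)

/-! ### The reduced quandle as a preimage under `φ_τ` -/

theorem nodeGen_mem_QAred (x : D.Node) : D.nodeGen x ∈ D.QAred :=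
  ⟨D.unitGen (GaussDiagram.arcOf x), SubquandleClosure.basic ⟨_, rfl⟩, rfl⟩

theorem twist_mem_QAred (s : ℤˣ) {x y : D.ReducedModule} (hx : x ∈ D.QAred) (hy : y ∈ D.QAred) :
    twist s y x ∈ D.QAred := by
  rcases Int.units_eq_one_or s with rfl | rfl
  · exact D.mem_QAred_act hx hy
  · exact D.mem_QAred_invAct hx hy

/-- Both operations of $Q_A(L)$ reduce to `twist` with sign $\pm1$, so induction needs only the
generators and `twist`, without reference to $M_A(L)$. -/
theorem QAred_induction {P : D.ReducedModule → Prop} (gen : ∀ x, P (D.nodeGen x))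
    (twist_mem : ∀ (s : ℤˣ) (x y : D.ReducedModule), x ∈ D.QAred → y ∈ D.QAred → P x → P y →
      P (twist s y x)) {z : D.ReducedModule} (hz : z ∈ D.QAred) : P z := by
  obtain ⟨x, hx, rfl⟩ := hz
  induction hx with
  | basic hx =>
    obtain ⟨a, rfl⟩ := hx
    obtain ⟨x, rfl⟩ : ∃ x : D.Node, GaussDiagram.arcOf x = a := Quot.exists_rep a
    exact gen x
  | @act y x hy hx ihy ihx =>
    rw [D.one_tmul_tri hx hy]
    exact twist_mem 1 _ _ ⟨x, hx, rfl⟩ ⟨y, hy, rfl⟩ ihx ihy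
  | @invAct y x hy hx ihy ihx =>
    have hz : y ◃⁻¹ x ∈ D.QA := SubquandleClosure.invAct hy hx
    have h := D.one_tmul_tri hz hy
    rw [Rack.act_invAct_eq] at h
    have h' : (1 : ℤ[T;T⁻¹]) ⊗ₜ[LaurentRing μ] (y ◃⁻¹ x).1
        = twist (-1) ((1 : ℤ[T;T⁻¹]) ⊗ₜ[LaurentRing μ] y.1)
          ((1 : ℤ[T;T⁻¹]) ⊗ₜ[LaurentRing μ] x.1) := by
      rw [h]
      exact (twist_neg_twist 1 _ _).symm
    rw [h']
    exact twist_mem (-1) _ _ ⟨x, hx, rfl⟩ ⟨y, hy, rfl⟩ ihx ihy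

theorem exists_phiTau_eq_of_mem_QAred {z : D.ReducedModule} (hz : z ∈ D.QAred) :
    ∃ i, D.phiTau z = eTau i := by
  refine D.QAred_induction (P := fun z => ∃ i, D.phiTau z = eTau i)
    (fun x => ⟨_, D.phiTau_nodeGen x⟩) (fun s x y _ _ hx hy => ?_) hz
  obtain ⟨i, hi⟩ := hx
  obtain ⟨j, hj⟩ := hy
  exact ⟨i, by rw [map_twist, hi, hj, twist_eTau]⟩

/-- The submodule of `M_A^red(L)` generated by the differences of elements of `Q_A^red(L)`. -/
def differences : Submodule ℤ[T;T⁻¹] D.ReducedModule :=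
  Submodule.span _ {d | ∃ y ∈ D.QAred, ∃ z ∈ D.QAred, d = y - z}

/-- The additive group generated by differences is already stable under $t^{\pm1}$, because
$t^{s}(y-z)$ is the difference of `twist s y y` and `twist s y z`. Translations then need checking
only for single differences. -/
theorem mem_closure_of_mem_differences {d : D.ReducedModule} (hd : d ∈ D.differences) :
    d ∈ AddSubgroup.closure {d | ∃ y ∈ D.QAred, ∃ z ∈ D.QAred, d = y - z} := by
  have hT : ∀ s : ℤˣ, ∀ d ∈ AddSubgroup.closure {d | ∃ y ∈ D.QAred, ∃ z ∈ D.QAred, d = y - z},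
      (T (s : ℤ) : ℤ[T;T⁻¹]) • d ∈
        AddSubgroup.closure {d | ∃ y ∈ D.QAred, ∃ z ∈ D.QAred, d = y - z} := by
    intro s d hd
    induction hd using AddSubgroup.closure_induction with
    | mem d hd =>
      obtain ⟨y, hy, z, hz, rfl⟩ := hd
      refine AddSubgroup.subset_closure
        ⟨twist s y y, D.twist_mem_QAred s hy hy, twist s y z, D.twist_mem_QAred s hz hy, ?_⟩
      unfold twist
      module
    | zero => rw [smul_zero]; exact zero_mem _
    | add x y _ _ hx hy => rw [smul_add]; exact add_mem hx hy
    | neg x _ hx => rw [smul_neg]; exact neg_mem hx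
  have hTn : ∀ n : ℤ, ∀ d ∈ AddSubgroup.closure {d | ∃ y ∈ D.QAred, ∃ z ∈ D.QAred, d = y - z},
      (T n : ℤ[T;T⁻¹]) • d ∈
        AddSubgroup.closure {d | ∃ y ∈ D.QAred, ∃ z ∈ D.QAred, d = y - z} := by
    intro n d hd
    induction n with
    | zero => simpa using hd
    | succ n ih => rw [add_comm, T_add, mul_smul]; exact hT 1 _ ih
    | pred n ih => rw [sub_eq_neg_add, T_add, mul_smul]; exact hT (-1) _ ih
  unfold differences at hd
  induction hd using Submodule.span_induction with
  | mem d hd => exact AddSubgroup.subset_closure hd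
  | zero => exact zero_mem _
  | add x y _ _ hx hy => exact add_mem hx hy
  | smul l x _ hx =>
    induction l using LaurentPolynomial.induction_on' with
    | add p q hp hq => rw [add_smul]; exact add_mem hp hq
    | C_mul_T n a =>
      rw [mul_smul, eq_intCast C a, Int.cast_smul_eq_zsmul]
      exact zsmul_mem (hTn n x hx) a

/-- The orbits of `Q_A^red(L)` are invariant under translations by `(1 - t) d`. -/
theorem add_smul_mem_QAred {q d : D.ReducedModule} (hq : q ∈ D.QAred) (hd : d ∈ D.differences) :
    q + (1 - T 1 : ℤ[T;T⁻¹]) • d ∈ D.QAred := by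
  have h := D.mem_closure_of_mem_differences hd
  have hgen : ∀ q ∈ D.QAred, ∀ y ∈ D.QAred, ∀ z ∈ D.QAred,
      q + (1 - T 1 : ℤ[T;T⁻¹]) • (y - z) ∈ D.QAred := by
    intro q hq y hy z hz
    have h1 := D.twist_mem_QAred 1 (D.twist_mem_QAred (-1) hq hz) hy
    -- Undoing the action of `z` and then acting by `y` is a translation: the linear parts cancel.
    have h2 : q + (1 - T 1 : ℤ[T;T⁻¹]) • (y - z) = twist 1 y (twist (-1) z q) := by
      have h3 : twist 1 y (twist (-1) z q)
          = twist 1 z (twist (-1) z q) + (1 - T 1 : ℤ[T;T⁻¹]) • (y - z) := by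
        unfold twist
        rw [Units.val_one]
        module
      rw [h3, twist_twist_neg]
    rwa [h2]
  -- Both signs are carried so that the induction passes to negatives, and all `q` so that
  -- translations compose.
  have : ∀ q ∈ D.QAred, q + (1 - T 1 : ℤ[T;T⁻¹]) • d ∈ D.QAred ∧
      q + (1 - T 1 : ℤ[T;T⁻¹]) • (-d) ∈ D.QAred := by
    clear hd
    induction h using AddSubgroup.closure_induction with
    | mem d hd =>
      obtain ⟨y, hy, z, hz, rfl⟩ := hd
      exact fun q hq => ⟨hgen q hq y hy z hz, by rw [neg_sub]; exact hgen q hq z hz y hy⟩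
    | zero => exact fun q hq => by simpa using hq
    | add x y _ _ hx hy =>
      intro q hq
      rw [neg_add, smul_add, smul_add, ← add_assoc, ← add_assoc]
      exact ⟨(hy _ (hx q hq).1).1, (hy _ (hx q hq).2).2⟩
    | neg x _ hx => exact fun q hq => ⟨(hx q hq).2, by rw [neg_neg]; exact (hx q hq).1⟩
  exact (this q hq).1

end LinkDiagram

/-- When $t$ fixes all differences of colors, underpasses change nothing, so the color is constant
along each closed curve. -/
theorem GaussDiagram.IsColoring.eq_of_κ_eq {μ : ℕ} {D : GaussDiagram μ} {X : Type} [AddCommGroup X]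
    [Module ℤ[T;T⁻¹] X] {c : D.Node → X} (hc : D.IsColoring c)
    (hT : ∀ x y, (T 1 : ℤ[T;T⁻¹]) • (c x - c y) = c x - c y) {x y : D.Node}
    (h : D.κ x = D.κ y) : c x = c y := by
  have hprev : ∀ y, c (D.next.symm y) = c y := fun y => by
    by_cases hy : ∀ k, D.underNode k ≠ y
    · exact (hc.step y hy).symm
    · push Not at hy
      obtain ⟨k, rfl⟩ := hy
      rw [hc.cross k, twist_eq_of_fixed _ (hT _ _)]
  have hnext : ∀ y, c (D.next y) = c y := fun y => by
    rw [← hprev (D.next y), Equiv.symm_apply_apply]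
  obtain ⟨n, rfl⟩ := (D.κ_eq_iff x y).1 h
  induction n with
  | zero => simp
  | succ n ih =>
    rw [add_comm, zpow_add, zpow_one, Equiv.Perm.mul_apply, hnext]
    exact ih ((D.κ_eq_iff _ _).2 ⟨_, rfl⟩)
  | pred n ih =>
    rw [sub_eq_neg_add, zpow_add, zpow_neg_one, Equiv.Perm.mul_apply]
    exact (ih ((D.κ_eq_iff _ _).2 ⟨_, rfl⟩)).trans (hprev _).symm

namespace LinkDiagram

variable {μ ν : ℕ} (D : LinkDiagram μ)

/-- Let `W` be $(1-t)$ times the span of differences. Modulo `W`, differences of generators are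
fixed by $t$, so one generator per component remains, and the class of an element can be computed
from its image under $\phi_\tau$. -/
theorem mem_differences_of_phiTau_eq_zero [Nonempty (Fin μ)] {d : D.ReducedModule}
    (hd : D.phiTau d = 0) : ∃ d' ∈ D.differences, (1 - T 1 : ℤ[T;T⁻¹]) • d' = d := by
  choose n hn using D.κ_surjective
  obtain ⟨i⟩ := ‹Nonempty (Fin μ)›
  set W : Submodule ℤ[T;T⁻¹] D.ReducedModule :=
    D.differences.map (LinearMap.lsmul ℤ[T;T⁻¹] D.ReducedModule (1 - T 1)) with hW
  have hdiff : ∀ x y, (T 1 : ℤ[T;T⁻¹]) • (W.mkQ (D.nodeGen x) - W.mkQ (D.nodeGen y))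
      = W.mkQ (D.nodeGen x) - W.mkQ (D.nodeGen y) := by
    intro x y
    rw [← sub_eq_zero, ← map_sub, ← map_smul, ← map_sub, Submodule.mkQ_apply,
      Submodule.Quotient.mk_eq_zero]
    refine ⟨D.nodeGen y - D.nodeGen x, Submodule.subset_span ⟨_, D.nodeGen_mem_QAred y, _,
      D.nodeGen_mem_QAred x, rfl⟩, ?_⟩
    rw [LinearMap.lsmul_apply]
    module
  -- The coefficient sum `p` is determined by $\phi_\tau$: $(t-1)p$ factors through $\phi_\tau$, and
  -- $\Lambda$ is a domain.
  set p := D.lift (D.isColoring_const (1 : ℤ[T;T⁻¹])) with hp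
  have hpd : p d = 0 := by
    have h : inclTau μ ∘ₗ D.phiTau = (T 1 - 1 : ℤ[T;T⁻¹]) • p := D.linearMap_ext fun x => by
      rw [LinearMap.comp_apply, phiTau_nodeGen, inclTau_eTau, LinearMap.smul_apply, hp,
        lift_nodeGen, smul_eq_mul, mul_one]
    have h' := LinearMap.congr_fun h d
    rw [LinearMap.comp_apply, hd, map_zero, LinearMap.smul_apply, smul_eq_mul] at h'
    exact (mul_eq_zero.1 h'.symm).resolve_left T_one_sub_one_ne_zero
  -- With `n i` as base point, the remaining coefficients matter only through their values at $t=1$,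
  -- since they multiply vectors fixed by $t$; `derivTau` reads off these values.
  have key : ∀ z, W.mkQ z = p z • W.mkQ (D.nodeGen (n i)) + ∑ j, derivTau j (D.phiTau z) •
      (W.mkQ (D.nodeGen (n j)) - W.mkQ (D.nodeGen (n i))) := by
    intro z
    have hz : z ∈ Submodule.span ℤ[T;T⁻¹] (Set.range D.nodeGen) := by
      rw [D.span_nodeGen]; trivial
    induction hz using Submodule.span_induction with
    | mem z hz =>
      obtain ⟨x, rfl⟩ := hz
      have hx : W.mkQ (D.nodeGen x) = W.mkQ (D.nodeGen (n (D.κ x))) :=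
        (D.isColoring_nodeGen.map W.mkQ).eq_of_κ_eq hdiff (hn _).symm
      rw [hp, lift_nodeGen, phiTau_nodeGen, hx]
      simp [derivTau_eTau]
    | zero => simp
    | add x y _ _ hx hy =>
      rw [map_add, hx, hy, map_add, map_add, add_smul]
      simp only [map_add, add_smul, Finset.sum_add_distrib]
      abel
    | smul l x _ hx =>
      rw [map_smul, hx, smul_add, map_smul, map_smul, smul_smul, smul_eq_mul, Finset.smul_sum]
      congr 1
      refine Finset.sum_congr rfl fun j _ => ?_
      rw [derivTau_smul, smul_comm, smul_eq_evalOne_smul (hdiff _ _), smul_smul, mul_comm]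
  have h0 : W.mkQ d = 0 := by
    rw [key, hpd, hd]
    simp
  rw [Submodule.mkQ_apply, Submodule.Quotient.mk_eq_zero] at h0
  exact h0

/-- `Q_A^red(L)` is the set of all elements whose image under `φ_τ` is some `(t_i - 1) ⊗ 1`. -/
theorem mem_QAred_iff {z : D.ReducedModule} : z ∈ D.QAred ↔ ∃ i, D.phiTau z = eTau i := by
  refine ⟨D.exists_phiTau_eq_of_mem_QAred, ?_⟩
  rintro ⟨i, hi⟩
  obtain ⟨x, hx⟩ := D.κ_surjective i
  have : Nonempty (Fin μ) := ⟨i⟩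
  -- An element over $e_i$ differs from a generator of the component $i$ by an element of
  -- $\ker\phi_\tau$, which is an admissible translation.
  obtain ⟨d, hd, he⟩ := D.mem_differences_of_phiTau_eq_zero (d := z - D.nodeGen x)
    (by rw [map_sub, hi, phiTau_nodeGen, hx, sub_self])
  have := D.add_smul_mem_QAred (D.nodeGen_mem_QAred x) hd
  rwa [he, add_sub_cancel] at this

/-! ### Quandle isomorphisms and linear isomorphisms -/

variable {D} {D' : LinkDiagram ν}

theorem quandleIsomorphic_of_linearEquiv (f : D.ReducedModule ≃ₗ[ℤ[T;T⁻¹]] D'.ReducedModule)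
    (hf : ∀ z, z ∈ D.QAred ↔ f z ∈ D'.QAred) : QuandleIsomorphic D.QAred D'.QAred := by
  refine ⟨f.toEquiv.subtypeEquiv hf, fun x y => Subtype.ext ?_⟩
  change f (twist 1 x.1 y.1) = twist 1 (f x.1) (f y.1)
  exact map_twist f.toLinearMap 1 x.1 y.1

theorem PhiTauEquivalent.quandleIsomorphic {D D' : LinkDiagram μ} (h : D.PhiTauEquivalent D') :
    QuandleIsomorphic D.QAred D'.QAred := by
  obtain ⟨f, hf⟩ := h
  exact quandleIsomorphic_of_linearEquiv f fun z => by rw [mem_QAred_iff, mem_QAred_iff, hf]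

variable (D) in
-- The coloring conditions do not involve `κ`. Although $\Lambda_\mu$ and $\Lambda_\nu$ differ as
-- base rings, both reduced modules are universal for the same colorings over $\Lambda$.
theorem exists_reindex_equiv (σ : Fin μ ≃ Fin ν) :
    ∃ f : D.ReducedModule ≃ₗ[ℤ[T;T⁻¹]] (D.reindex σ).ReducedModule,
      ∀ x, f (D.nodeGen x) = (D.reindex σ).nodeGen x :=
  exists_equiv_of_transfer (D' := D.reindex σ) (p := id) (q := fun x : D.Node => x)
    (GaussDiagram.coloringDetermined_of_surjective Function.surjective_id)
    (GaussDiagram.coloringDetermined_of_surjective Function.surjective_id)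
    (fun _ _ _ c hc => ⟨c, ⟨hc.step, hc.cross⟩, fun _ => rfl⟩)
    (fun _ _ _ c hc => ⟨c, ⟨hc.step, hc.cross⟩, fun _ => rfl⟩)

theorem mem_QAred_of_nodeGen (f : D.ReducedModule →ₗ[ℤ[T;T⁻¹]] D'.ReducedModule)
    (hf : ∀ x, f (D.nodeGen x) ∈ D'.QAred) {z : D.ReducedModule} (hz : z ∈ D.QAred) :
    f z ∈ D'.QAred :=
  D.QAred_induction (P := fun z => f z ∈ D'.QAred) hf (fun s x y _ _ hx hy => by
    rw [map_twist]; exact D'.twist_mem_QAred s hx hy) hz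

variable (D) in
theorem quandleIsomorphic_reindex (σ : Fin μ ≃ Fin ν) :
    QuandleIsomorphic D.QAred (D.reindex σ).QAred := by
  obtain ⟨f, hf⟩ := D.exists_reindex_equiv σ
  refine quandleIsomorphic_of_linearEquiv f fun z => ⟨fun hz => ?_, fun hz => ?_⟩
  · refine mem_QAred_of_nodeGen f.toLinearMap (fun x => ?_) hz
    exact (hf x).symm ▸ nodeGen_mem_QAred _ _
  · have := mem_QAred_of_nodeGen f.symm.toLinearMap (fun x => ?_) hz
    · simpa using this
    · have : f.symm ((D.reindex σ).nodeGen x) = D.nodeGen x := by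
        rw [LinearEquiv.symm_apply_eq]; exact (hf x).symm
      exact this.symm ▸ D.nodeGen_mem_QAred x

end LinkDiagram

theorem QuandleIsomorphic.trans {P Q R : Type} [Quandle P] [Quandle Q] [Quandle R]
    (h : QuandleIsomorphic P Q) (h' : QuandleIsomorphic Q R) : QuandleIsomorphic P R := by
  obtain ⟨f, hf⟩ := h
  obtain ⟨f', hf'⟩ := h'
  exact ⟨f.trans f', fun x y => by simp [hf, hf']⟩

theorem map_invAct_of_map_act {P Q : Type} [Quandle P] [Quandle Q] {f : P → Q}
    (hf : ∀ x y, f (x ◃ y) = f x ◃ f y) (x y : P) : f (x ◃⁻¹ y) = f x ◃⁻¹ f y := by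
  rw [← Rack.left_cancel (f x), ← hf, Rack.act_invAct_eq, Rack.act_invAct_eq]

namespace LinkDiagram

variable {μ ν : ℕ} {D : LinkDiagram μ} {D' : LinkDiagram ν}

/-- A homomorphism of reduced quandles extends to a linear map. -/
theorem exists_linearMap_of_quandleHom {F : D.QAred → D'.QAred}
    (hF : ∀ x y, F (x ◃ y) = F x ◃ F y) :
    ∃ f : D.ReducedModule →ₗ[ℤ[T;T⁻¹]] D'.ReducedModule, ∀ z : D.QAred, f z = F z := by
  have htwist : ∀ (s : ℤˣ) (x y : D.QAred) (h : twist s x.1 y.1 ∈ D.QAred),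
      (F ⟨_, h⟩ : D'.ReducedModule) = twist s (F x).1 (F y).1 := by
    intro s x y h
    rcases Int.units_eq_one_or s with rfl | rfl
    · exact congrArg Subtype.val (hF x y)
    · exact congrArg Subtype.val (map_invAct_of_map_act hF x y)
  -- The coloring rules use only quandle operations, so `F` transports the universal coloring.
  have hc : D.IsColoring fun x => (F ⟨_, D.nodeGen_mem_QAred x⟩ : D'.ReducedModule) := by
    constructor
    · intro y hy
      simp only [D.isColoring_nodeGen.step y hy]
    · intro k
      rw [← htwist _ _ _ (D.twist_mem_QAred _ (D.nodeGen_mem_QAred _) (D.nodeGen_mem_QAred _))]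
      simp only [D.isColoring_nodeGen.cross k]
  refine ⟨D.lift hc, fun z => ?_⟩
  have := D.QAred_induction (P := fun z => ∀ h : z ∈ D.QAred, D.lift hc z = F ⟨z, h⟩)
    (fun x h => by simp) (fun s x y hx hy ihx ihy h => by
      rw [map_twist, ihx hx, ihy hy, htwist s ⟨y, hy⟩ ⟨x, hx⟩]) z.2
  exact this z.2

/-- A linear map that preserves the reduced quandles induces a map of component indices. -/
theorem exists_index_map (f : D.ReducedModule →ₗ[ℤ[T;T⁻¹]] D'.ReducedModule)
    (hf : ∀ z ∈ D.QAred, f z ∈ D'.QAred) :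
    ∃ σ : Fin μ → Fin ν, ∀ z ∈ D.QAred, ∀ i, D.phiTau z = eTau i →
      D'.phiTau (f z) = eTau (σ i) := by
  choose n hn using D.κ_surjective
  have h : ∀ x, ∃ j, D'.phiTau (f (D.nodeGen x)) = eTau j := fun x =>
    D'.mem_QAred_iff.1 (hf _ (D.nodeGen_mem_QAred x))
  choose s hs using h
  have hcol := D.isColoring_nodeGen.map (D'.phiTau ∘ₗ f)
  have hs' : ∀ x, D'.phiTau (f (D.nodeGen x)) = eTau (s (n (D.κ x))) := fun x => by
    rw [← hs]
    -- All colors are of the form $e_j$, and their differences are fixed by $t$; so the color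
    -- depends only on the component.
    refine hcol.eq_of_κ_eq (fun x y => ?_) (hn _).symm
    simp only [LinearMap.comp_apply, hs]
    exact T_smul_eTau_sub _ _
  refine ⟨fun i => s (n i), fun z hz i hi => ?_⟩
  obtain ⟨j, hj, hj'⟩ := D.QAred_induction
    (P := fun z => ∃ i, D.phiTau z = eTau i ∧ D'.phiTau (f z) = eTau (s (n i)))
    (fun x => ⟨_, D.phiTau_nodeGen x, hs' x⟩) (fun t x y _ _ hx hy => by
      obtain ⟨i, hi, hi'⟩ := hx
      obtain ⟨j, hj, hj'⟩ := hy
      exact ⟨i, by rw [map_twist, hi, hj, twist_eTau],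
        by rw [map_twist, map_twist, hi', hj', twist_eTau]⟩) hz
  rw [hi] at hj
  rw [hj', eTau_injective hj]

/-- The linear extensions of `F` and its inverse are mutually inverse on generators. Their index
maps are mutually inverse because the $e_i$ are distinct, which yields the bijection of components.
-/
theorem exists_phiTauEquivalent_of_quandleIsomorphic (h : QuandleIsomorphic D.QAred D'.QAred) :
    ∃ σ : Fin μ ≃ Fin ν, (D.reindex σ).PhiTauEquivalent D' := by
  obtain ⟨F, hF⟩ := h
  have hF' : ∀ x y, F.symm (x ◃ y) = F.symm x ◃ F.symm y := fun x y => by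
    rw [Equiv.symm_apply_eq, hF]; simp
  obtain ⟨f, hf⟩ := exists_linearMap_of_quandleHom hF
  obtain ⟨f', hf'⟩ := exists_linearMap_of_quandleHom hF'
  have hff' : ∀ z ∈ D.QAred, f' (f z) = z := fun z hz => by
    rw [hf ⟨z, hz⟩, hf', Equiv.symm_apply_apply]
  have hf'f : ∀ z ∈ D'.QAred, f (f' z) = z := fun z hz => by
    rw [hf' ⟨z, hz⟩, hf, Equiv.apply_symm_apply]
  have hfm : ∀ z ∈ D.QAred, f z ∈ D'.QAred := fun z hz => by
    rw [hf ⟨z, hz⟩]; exact (F _).2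
  have hfm' : ∀ z ∈ D'.QAred, f' z ∈ D.QAred := fun z hz => by
    rw [hf' ⟨z, hz⟩]; exact (F.symm _).2
  obtain ⟨σ, hσ⟩ := exists_index_map f hfm
  obtain ⟨τ, hτ⟩ := exists_index_map f' hfm'
  have hτσ : ∀ i, τ (σ i) = i := fun i => by
    obtain ⟨x, hx⟩ := D.κ_surjective i
    have hg := D.nodeGen_mem_QAred x
    have hi : D.phiTau (D.nodeGen x) = eTau i := by rw [phiTau_nodeGen, hx]
    have := hτ _ (hfm _ hg) _ (hσ _ hg i hi)
    rw [hff' _ hg, hi] at this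
    exact (eTau_injective this).symm
  have hστ : ∀ i, σ (τ i) = i := fun i => by
    obtain ⟨x, hx⟩ := D'.κ_surjective i
    have hg := D'.nodeGen_mem_QAred x
    have hi : D'.phiTau (D'.nodeGen x) = eTau i := by rw [phiTau_nodeGen, hx]
    have := hσ _ (hfm' _ hg) _ (hτ _ hg i hi)
    rw [hf'f _ hg, hi] at this
    exact (eTau_injective this).symm
  let e : Fin μ ≃ Fin ν := ⟨σ, τ, hτσ, hστ⟩
  let fe : D.ReducedModule ≃ₗ[ℤ[T;T⁻¹]] D'.ReducedModule := LinearEquiv.ofLinearMap f f'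
    (D'.linearMap_ext fun x => hf'f _ (D'.nodeGen_mem_QAred x))
    (D.linearMap_ext fun x => hff' _ (D.nodeGen_mem_QAred x))
  -- Re-indexing by `e` absorbs the index map, so that the composite preserves $\phi_\tau$ on
  -- generators.
  obtain ⟨r, hr⟩ := D.exists_reindex_equiv e
  refine ⟨e, r.symm.trans fe, fun z => ?_⟩
  have key : (D.reindex e).phiTau = D'.phiTau ∘ₗ (r.symm.trans fe).toLinearMap :=
    (D.reindex e).linearMap_ext fun x => by
      have hx : r.symm ((D.reindex e).nodeGen x) = D.nodeGen x := by
        rw [LinearEquiv.symm_apply_eq]; exact (hr x).symm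
      rw [phiTau_nodeGen, LinearMap.comp_apply, LinearEquiv.coe_coe, LinearEquiv.trans_apply, hx]
      exact (hσ _ (D.nodeGen_mem_QAred x) _ (D.phiTau_nodeGen x)).symm
  exact LinearMap.congr_fun key z

end LinkDiagram

end

theorem theorem2 :
    (∀ (μ : ℕ) (D D' : LinkDiagram μ), D.Equivalent D' →
      QuandleIsomorphic D.QAred D'.QAred ∧ D.PhiTauEquivalent D') ∧
    (∀ (μ μ' : ℕ) (D : LinkDiagram μ) (D' : LinkDiagram μ'),
      QuandleIsomorphic D.QAred D'.QAred ↔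
        ∃ σ : Fin μ ≃ Fin μ', (D.reindex σ).PhiTauEquivalent D') := by
  refine ⟨fun μ D D' h => ⟨h.phiTauEquivalent.quandleIsomorphic, h.phiTauEquivalent⟩,
    fun μ μ' D D' => ⟨LinkDiagram.exists_phiTauEquivalent_of_quandleIsomorphic, ?_⟩⟩
  rintro ⟨σ, h⟩
  exact (D.quandleIsomorphic_reindex σ).trans h.quandleIsomorphic
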